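/- Let $\mathcal{A}$ be a complex unital associative algebra with product $m\colon\mathcal{A}\otimes\mathcal{A}\to\mathcal{A}$ and unit $1$, which is also a coassociative counital coalgebra with coproduct $\phi\colon\mathcal{A}\to\mathcal{A}\otimes\mathcal{A}$ and counit $\epsilon\colon\mathcal{A}\to\mathbb{C}$. Let $\kappa\colon\mathcal{A}\to\mathcal{A}$ and $\sigma\colon\mathcal{A}\otimes\mathcal{A}\to\mathcal{A}\otimes\mathcal{A}$ be bijective linear maps such that $(\mathcal{A},\{\phi,\epsilon,\kappa,\sigma\})$ is a braided quantum group, that is, \begin{align*} \sigma(m\otimes\mathrm{id})&=(\mathrm{id}\otimes m)(\sigma\otimes\mathrm{id})(\mathrm{id}\otimes\sigma),\\ \sigma(\mathrm{id}\otimes m)&=(m\otimes\mathrm{id})(\mathrm{id}\otimes\sigma)(\sigma\otimes\mathrm{id}),\\ \phi m&=(m\otimes m)(\mathrm{id}\otimes\sigma\otimes\mathrm{id})(\phi\otimes\phi),\\ (\sigma\otimes\mathrm{id}^2)(\mathrm{id}\otimes\phi\otimes\mathrm{id})(\sigma^{-1}\otimes\mathrm{id})(\mathrm{id}\otimes\phi)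 &=(\mathrm{id}^2\otimes\sigma)(\mathrm{id}\otimes\phi\otimes\mathrm{id})(\mathrm{id}\otimes\sigma^{-1})(\phi\otimes\mathrm{id}),\\ m(\mathrm{id}\otimes\kappa)\phi&=m(\kappa\otimes\mathrm{id})\phi=1\epsilon. \end{align*} Define $\tau\colon\mathcal{A}\otimes\mathcal{A}\to\mathcal{A}\otimes\mathcal{A}$ by $\tau=(\mathrm{id}^2\otimes\epsilon)(\mathrm{id}\otimes\sigma^{-1})(\phi\otimes\mathrm{id})\sigma$. Then the following eight identities of linear maps on $\mathcal{A}\otimes\mathcal{A}\otimes\mathcal{A}$ hold: \begin{align*} (\sigma\otimes\mathrm{id})(\mathrm{id}\otimes\sigma)(\sigma\otimes\mathrm{id})&=(\mathrm{id}\otimes\sigma)(\sigma\otimes\mathrm{id})(\mathrm{id}\otimes\sigma),\\ (\tau\otimes\mathrm{id})(\mathrm{id}\otimes\sigma)(\sigma\otimes\mathrm{id})&=(\mathrm{id}\otimes\sigma)(\sigma\otimes\mathrm{id})(\mathrm{id}\otimes\tau),\\ (\sigma\otimes\mathrm{id})(\mathrm{id}\otimes\tau)(\sigma\otimes\mathrm{id})&=(\mathrm{id}\otimes\sigma)(\tau\otimes\mathrm{id})(\mathrm{id}\otimes\sigma),\\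 (\sigma\otimes\mathrm{id})(\mathrm{id}\otimes\sigma)(\tau\otimes\mathrm{id})&=(\mathrm{id}\otimes\tau)(\sigma\otimes\mathrm{id})(\mathrm{id}\otimes\sigma),\\ (\tau\otimes\mathrm{id})(\mathrm{id}\otimes\tau)(\sigma\otimes\mathrm{id})&=(\mathrm{id}\otimes\sigma)(\tau\otimes\mathrm{id})(\mathrm{id}\otimes\tau),\\ (\tau\otimes\mathrm{id})(\mathrm{id}\otimes\sigma)(\tau\otimes\mathrm{id})&=(\mathrm{id}\otimes\tau)(\sigma\otimes\mathrm{id})(\mathrm{id}\otimes\tau),\\ (\sigma\otimes\mathrm{id})(\mathrm{id}\otimes\tau)(\tau\otimes\mathrm{id})&=(\mathrm{id}\otimes\tau)(\tau\otimes\mathrm{id})(\mathrm{id}\otimes\sigma),\\ (\tau\otimes\mathrm{id})(\mathrm{id}\otimes\tau)(\tau\otimes\mathrm{id})&=(\mathrm{id}\otimes\tau)(\tau\otimes\mathrm{id})(\mathrm{id}\otimes\tau). \end{align*} That is, $(\alpha\otimes\mathrm{id})(\mathrm{id}\otimes\beta)(\gamma\otimes\mathrm{id})=(\mathrm{id}\otimes\gamma)(\beta\otimes\mathrm{id})(\mathrm{id}\otimes\alpha)$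 for all $\alpha,\beta,\gamma\in\{\sigma,\tau\}$; in particular $\sigma$ and $\tau$ each satisfy the braid equation. -/

import Mathlib

open scoped TensorProduct

noncomputable section

namespace BraidedQG

variable {A : Type*} [Ring A] [Algebra ℂ A]

/-- For a linear map `f` of `A ⊗ A` and a complex vector space `M`, the map `f ⊗ id` of
`A ⊗ A ⊗ M`. Iterated tensor products are bracketed to the right throughout. -/
def tensorId (M : Type*) [AddCommGroup M] [Module ℂ M] (f : A ⊗[ℂ] A →ₗ[ℂ] A ⊗[ℂ] A) :
    A ⊗[ℂ] (A ⊗[ℂ] M) →ₗ[ℂ] A ⊗[ℂ] (A ⊗[ℂ] M) :=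
  (TensorProduct.assoc ℂ A A M).toLinearMap ∘ₗ f.rTensor M ∘ₗ
    (TensorProduct.assoc ℂ A A M).symm.toLinearMap

/-- For a linear map `f` of `A ⊗ A`, the map `id ⊗ f` of `A ⊗ A ⊗ A`. -/
def idTensor (f : A ⊗[ℂ] A →ₗ[ℂ] A ⊗[ℂ] A) :
    A ⊗[ℂ] (A ⊗[ℂ] A) →ₗ[ℂ] A ⊗[ℂ] (A ⊗[ℂ] A) :=
  f.lTensor A

/-- `m ⊗ id : A ⊗ A ⊗ A → A ⊗ A`, where `m` is the product of `A`. -/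
def mulTensorId : A ⊗[ℂ] (A ⊗[ℂ] A) →ₗ[ℂ] A ⊗[ℂ] A :=
  (LinearMap.mul' ℂ A).rTensor A ∘ₗ (TensorProduct.assoc ℂ A A A).symm.toLinearMap

/-- `id ⊗ m : A ⊗ A ⊗ A → A ⊗ A`, where `m` is the product of `A`. -/
def idTensorMul : A ⊗[ℂ] (A ⊗[ℂ] A) →ₗ[ℂ] A ⊗[ℂ] A :=
  (LinearMap.mul' ℂ A).lTensor A

/-- `id ⊗ f ⊗ id` on `(A ⊗ A) ⊗ (A ⊗ A)`, for a linear map `f` of `A ⊗ A`. -/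
def idTensorTensorId (f : A ⊗[ℂ] A →ₗ[ℂ] A ⊗[ℂ] A) :
    (A ⊗[ℂ] A) ⊗[ℂ] (A ⊗[ℂ] A) →ₗ[ℂ] (A ⊗[ℂ] A) ⊗[ℂ] (A ⊗[ℂ] A) :=
  (TensorProduct.assoc ℂ A A (A ⊗[ℂ] A)).symm.toLinearMap ∘ₗ
    (tensorId A f).lTensor A ∘ₗ
    (TensorProduct.assoc ℂ A A (A ⊗[ℂ] A)).toLinearMap

variable [Coalgebra ℂ A]

/-- `φ ⊗ id : A ⊗ A → A ⊗ A ⊗ A`, where `φ` is the coproduct of `A`. -/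
def comulTensorId : A ⊗[ℂ] A →ₗ[ℂ] A ⊗[ℂ] (A ⊗[ℂ] A) :=
  (TensorProduct.assoc ℂ A A A).toLinearMap ∘ₗ (Coalgebra.comul (R := ℂ) (A := A)).rTensor A

/-- `id ⊗ φ : A ⊗ A → A ⊗ A ⊗ A`, where `φ` is the coproduct of `A`. -/
def idTensorComul : A ⊗[ℂ] A →ₗ[ℂ] A ⊗[ℂ] (A ⊗[ℂ] A) :=
  (Coalgebra.comul (R := ℂ) (A := A)).lTensor A

/-- `id² ⊗ ε : A ⊗ A ⊗ A → A ⊗ A`, where `ε` is the counit of `A`. -/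
def idIdTensorCounit : A ⊗[ℂ] (A ⊗[ℂ] A) →ₗ[ℂ] A ⊗[ℂ] A :=
  ((TensorProduct.rid ℂ A).toLinearMap ∘ₗ (Coalgebra.counit (R := ℂ) (A := A)).lTensor A).lTensor A

end BraidedQG

open BraidedQG in
/-- A braided quantum group structure on a complex unital associative algebra `A` that is also
a coassociative counital coalgebra: a bijective antipode `κ` and a bijective flip-over operator
`σ`. No compatibility between the algebra and the coalgebra structure is assumed other than the
fields below. -/
structure BraidedQuantumGroup (A : Type*) [Ring A] [Algebra ℂ A] [Coalgebra ℂ A] where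
  /-- the antipode -/
  κ : A ≃ₗ[ℂ] A
  /-- the flip-over operator -/
  σ : A ⊗[ℂ] A ≃ₗ[ℂ] A ⊗[ℂ] A
  /-- `σ (m ⊗ id) = (id ⊗ m) (σ ⊗ id) (id ⊗ σ)` -/
  flip_mul_left : σ.toLinearMap ∘ₗ mulTensorId =
    idTensorMul ∘ₗ tensorId A σ.toLinearMap ∘ₗ idTensor σ.toLinearMap
  /-- `σ (id ⊗ m) = (m ⊗ id) (id ⊗ σ) (σ ⊗ id)` -/
  flip_mul_right : σ.toLinearMap ∘ₗ idTensorMul =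
    mulTensorId ∘ₗ idTensor σ.toLinearMap ∘ₗ tensorId A σ.toLinearMap
  /-- `φ m = (m ⊗ m) (id ⊗ σ ⊗ id) (φ ⊗ φ)` -/
  comul_mul : Coalgebra.comul (R := ℂ) (A := A) ∘ₗ LinearMap.mul' ℂ A =
    TensorProduct.map (LinearMap.mul' ℂ A) (LinearMap.mul' ℂ A) ∘ₗ
      idTensorTensorId σ.toLinearMap ∘ₗ
      TensorProduct.map (Coalgebra.comul (R := ℂ) (A := A)) (Coalgebra.comul (R := ℂ) (A := A))
  /-- `(σ ⊗ id²) (id ⊗ φ ⊗ id) (σ⁻¹ ⊗ id) (id ⊗ φ) =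
  (id² ⊗ σ) (id ⊗ φ ⊗ id) (id ⊗ σ⁻¹) (φ ⊗ id)` -/
  flip_comul :
    tensorId (A ⊗[ℂ] A) σ.toLinearMap ∘ₗ comulTensorId.lTensor A ∘ₗ
      tensorId A σ.symm.toLinearMap ∘ₗ idTensorComul =
    (idTensor σ.toLinearMap).lTensor A ∘ₗ comulTensorId.lTensor A ∘ₗ
      idTensor σ.symm.toLinearMap ∘ₗ comulTensorId
  /-- `m (id ⊗ κ) φ = 1 ε` -/
  mul_antipode_right :
    LinearMap.mul' ℂ A ∘ₗ κ.toLinearMap.lTensor A ∘ₗ Coalgebra.comul (R := ℂ) (A := A) =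
      Algebra.linearMap ℂ A ∘ₗ Coalgebra.counit (R := ℂ) (A := A)
  /-- `m (κ ⊗ id) φ = 1 ε` -/
  mul_antipode_left :
    LinearMap.mul' ℂ A ∘ₗ κ.toLinearMap.rTensor A ∘ₗ Coalgebra.comul (R := ℂ) (A := A) =
      Algebra.linearMap ℂ A ∘ₗ Coalgebra.counit (R := ℂ) (A := A)

/-- The secondary flip-over operator `τ = (id² ⊗ ε) (id ⊗ σ⁻¹) (φ ⊗ id) σ`. -/
def BraidedQuantumGroup.τ {A : Type*} [Ring A] [Algebra ℂ A] [Coalgebra ℂ A]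
    (G : BraidedQuantumGroup A) : A ⊗[ℂ] A →ₗ[ℂ] A ⊗[ℂ] A :=
  BraidedQG.idIdTensorCounit ∘ₗ BraidedQG.idTensor G.σ.symm.toLinearMap ∘ₗ
    BraidedQG.comulTensorId ∘ₗ G.σ.toLinearMap

end

/-!
Let `E` be the endomorphism algebra of a module `M ≅ A ⊗ M`. A map between tensor powers of `A`,
tensored with the identity of `M`, becomes an element of `E`, and `h ↦ id ⊗ h` becomes an
endomorphism of the monoid `E`; a map of `i` factors into `j` factors satisfies
`g * S^[i] h = S^[j] h * g`. Identities of maps of different tensor powers are thus identities of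
words in one monoid.

By the antipode identities the canonical maps `(m ⊗ id) (id ⊗ φ)` and `(id ⊗ m) (φ ⊗ id)` are
invertible, so they can be cancelled. Expanding `ε m` and `φ m` by the multiplicativity of `φ` then
shows that `ρ = σ⁻¹ τ` commutes with coproducts and is invertible. Put `υ = σ τ⁻¹ σ`. Each of
`σ`, `τ`, `υ` can be slid past products, and a coproduct turns any one of them into two flips:
`φ c = (id ⊗ b) (a ⊗ id) (id ⊗ φ)` holds for `(a, b, c)` equal to `(σ, σ, υ)`, `(τ, σ, σ)`,
`(σ, τ, σ)` and `(τ, τ, τ)`.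

Computing `φ c (id ⊗ m)` in two ways, by moving the product through `c` before or after taking the
coproduct, and cancelling canonical maps, gives the identities with `α = σ`. Those with `α = τ`
follow because `τ σ⁻¹ = (id² ⊗ ε) (id ⊗ σ⁻¹) (φ ⊗ id)` can be slid past the remaining crossings.
-/

/-- `g` transforms the first `i` factors of a power into `j` factors, leaving the others alone;
`S` is the operation `h ↦ id ⊗ h`. -/
def IsLocal {E : Type*} [Monoid E] (S : E →* E) (i j : ℕ) (g : E) : Prop :=
  ∀ h, g * S^[i] h = S^[j] h * g

namespace IsLocal

variable {E : Type*} [Monoid E] {S : E →* E} {i j l : ℕ} {a b : E}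

theorem mul (ha : IsLocal S j l a) (hb : IsLocal S i j b) : IsLocal S i l (a * b) := fun h => by
  rw [mul_assoc, hb, ← mul_assoc, ha, mul_assoc]

theorem succ (ha : IsLocal S i j a) : IsLocal S (i + 1) (j + 1) a := fun h => by
  simpa using ha (S h)

theorem shift (ha : IsLocal S i j a) : IsLocal S (i + 1) (j + 1) (S a) := fun h => by
  simpa only [Function.iterate_succ_apply', map_mul] using congrArg S (ha h)

theorem units_inv {u : Eˣ} (hu : IsLocal S i j u) : IsLocal S j i ↑u⁻¹ := fun h => by
  rw [Units.inv_mul_eq_iff_eq_mul, ← mul_assoc, hu h, Units.mul_inv_cancel_right]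

end IsLocal

/-- The structure maps of a braided Hopf algebra `A`, as elements of the monoid of endomorphisms
of a module `M ≅ A ⊗ M`. Every map between powers of `A` is thought of as acting on the leading
factors of `A ⊗ (A ⊗ (⋯))`, and `shift g` is `id ⊗ g`. -/
structure BraidedCalculus (E : Type*) [Monoid E] where
  shift : E →* E
  flip : Eˣ
  mul : E
  comul : E
  counit : E
  antipode : E
  unit : E
  isLocal_flip : IsLocal shift 2 2 flip
  isLocal_mul : IsLocal shift 2 1 mul
  isLocal_comul : IsLocal shift 1 2 comul
  isLocal_counit : IsLocal shift 1 0 counit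
  isLocal_antipode : IsLocal shift 1 1 antipode
  isLocal_unit : IsLocal shift 0 1 unit
  mul_mul : mul * mul = mul * shift mul
  mul_unit : mul * unit = 1
  mul_shift_unit : mul * shift unit = 1
  comul_comul : comul * comul = shift comul * comul
  counit_comul : counit * comul = 1
  shift_counit_comul : shift counit * comul = 1
  flip_mul : flip * mul = shift mul * flip * shift flip
  flip_shift_mul : flip * shift mul = mul * shift flip * flip
  comul_mul : comul * mul = mul * shift (shift mul) * shift flip * comul * shift comul
  flip_comul : flip * shift comul * ↑flip⁻¹ * shift comul =
    shift (shift flip) * shift comul * shift ↑flip⁻¹ * comul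
  mul_shift_antipode_comul : mul * shift antipode * comul = unit * counit
  mul_antipode_comul : mul * antipode * comul = unit * counit

namespace BraidedCalculus

variable {E : Type*} [Monoid E] (C : BraidedCalculus E) (k : ℕ) (w : E)

/-- The operator `g` at position `k`, followed on the right by the word `w`. Writing words as
nested applications of `act` makes rewriting insensitive to association. -/
def act (g : E) (k : ℕ) (w : E) : E := C.shift^[k] g * w

theorem act_mul (a b : E) : C.act (a * b) k w = C.act a k (C.act b k w) := by
  simp [act, iterate_map_mul, mul_assoc]

theorem act_one : C.act 1 k w = w := by
  simp [act, iterate_map_one]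

theorem act_shift (a : E) : C.act (C.shift a) k w = C.act a (k + 1) w := by
  simp [act]

theorem act_congr {a b : E} (h : a = b) : C.act a k w = C.act b k w := by rw [h]

theorem ext {a b : E} (h : ∀ w, C.act a 0 w = C.act b 0 w) : a = b := by
  simpa [act] using h 1

variable {C k} in
theorem act_comm {i j : ℕ} {g : E} (hg : IsLocal C.shift i j g) {a : ℕ} (hk : k + i ≤ a)
    (h w : E) : C.act g k (C.act h a w) = C.act h (a + j - i) (C.act g k w) := by
  obtain ⟨n, rfl⟩ := Nat.exists_eq_add_of_le hk
  have := congrArg (C.shift^[k]) (hg (C.shift^[n] h))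
  simp only [iterate_map_mul, ← Function.iterate_add_apply, ← add_assoc] at this
  rw [show k + i + n + j - i = k + j + n by omega]
  simp only [act, ← mul_assoc, this]

section FarCommutation

variable {k} {a : ℕ} (h : E)

theorem act_flip_comm (hk : k + 2 ≤ a) :
    C.act C.flip k (C.act h a w) = C.act h a (C.act C.flip k w) :=
  act_comm C.isLocal_flip hk h w

theorem act_flipInv_comm (hk : k + 2 ≤ a) :
    C.act ↑C.flip⁻¹ k (C.act h a w) = C.act h a (C.act ↑C.flip⁻¹ k w) :=
  act_comm C.isLocal_flip.units_inv hk h w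

theorem act_mul_comm (hk : k + 2 ≤ a) :
    C.act C.mul k (C.act h a w) = C.act h (a - 1) (C.act C.mul k w) :=
  act_comm C.isLocal_mul hk h w

theorem act_comul_comm (hk : k + 1 ≤ a) :
    C.act C.comul k (C.act h a w) = C.act h (a + 1) (C.act C.comul k w) :=
  act_comm C.isLocal_comul hk h w

theorem act_counit_comm (hk : k + 1 ≤ a) :
    C.act C.counit k (C.act h a w) = C.act h (a - 1) (C.act C.counit k w) :=
  act_comm C.isLocal_counit hk h w

theorem act_antipode_comm (hk : k + 1 ≤ a) :
    C.act C.antipode k (C.act h a w) = C.act h a (C.act C.antipode k w) :=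
  act_comm C.isLocal_antipode hk h w

theorem act_unit_comm (hk : k ≤ a) :
    C.act C.unit k (C.act h a w) = C.act h (a + 1) (C.act C.unit k w) :=
  act_comm C.isLocal_unit hk h w

end FarCommutation

attribute [local simp] act_mul act_shift act_one act_flip_comm act_flipInv_comm act_mul_comm
  act_comul_comm act_counit_comm act_antipode_comm act_unit_comm

local notation "𝛔" => act C (Units.val (flip C))
local notation "𝛔⁻" => act C (Units.val (flip C)⁻¹)
local notation "𝐦" => act C (mul C)
local notation "𝛗" => act C (comul C)
local notation "𝛆" => act C (counit C)
local notation "𝛋" => act C (antipode C)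
local notation "𝛈" => act C (unit C)

theorem act_flip_flipInv : 𝛔 k (𝛔⁻ k w) = w := by
  rw [← act_mul, Units.mul_inv, act_one]

theorem act_flipInv_flip : 𝛔⁻ k (𝛔 k w) = w := by
  rw [← act_mul, Units.inv_mul, act_one]

theorem act_mul_mul : 𝐦 k (𝐦 k w) = 𝐦 k (𝐦 (k + 1) w) := by
  simpa using C.act_congr k w C.mul_mul

theorem act_mul_unit : 𝐦 k (𝛈 k w) = w := by
  simpa using C.act_congr k w C.mul_unit

theorem act_mul_shift_unit : 𝐦 k (𝛈 (k + 1) w) = w := by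
  simpa using C.act_congr k w C.mul_shift_unit

theorem act_comul_comul : 𝛗 k (𝛗 k w) = 𝛗 (k + 1) (𝛗 k w) := by
  simpa using C.act_congr k w C.comul_comul

theorem act_counit_comul : 𝛆 k (𝛗 k w) = w := by
  simpa using C.act_congr k w C.counit_comul

theorem act_shift_counit_comul : 𝛆 (k + 1) (𝛗 k w) = w := by
  simpa using C.act_congr k w C.shift_counit_comul

theorem act_flip_mul : 𝛔 k (𝐦 k w) = 𝐦 (k + 1) (𝛔 k (𝛔 (k + 1) w)) := by
  simpa using C.act_congr k w C.flip_mul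

theorem act_flip_shift_mul : 𝛔 k (𝐦 (k + 1) w) = 𝐦 k (𝛔 (k + 1) (𝛔 k w)) := by
  simpa using C.act_congr k w C.flip_shift_mul

theorem act_comul_mul :
    𝛗 k (𝐦 k w) = 𝐦 k (𝐦 (k + 2) (𝛔 (k + 1) (𝛗 k (𝛗 (k + 1) w)))) := by
  simpa using C.act_congr k w C.comul_mul

theorem act_flip_comul : 𝛔 k (𝛗 (k + 1) (𝛔⁻ k (𝛗 (k + 1) w))) =
    𝛔 (k + 2) (𝛗 (k + 1) (𝛔⁻ (k + 1) (𝛗 k w))) := by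
  simpa using C.act_congr k w C.flip_comul

theorem act_mul_shift_antipode_comul : 𝐦 k (𝛋 (k + 1) (𝛗 k w)) = 𝛈 k (𝛆 k w) := by
  simpa using C.act_congr k w C.mul_shift_antipode_comul

theorem act_mul_antipode_comul : 𝐦 k (𝛋 k (𝛗 k w)) = 𝛈 k (𝛆 k w) := by
  simpa using C.act_congr k w C.mul_antipode_comul

/-! ### The canonical maps -/

theorem mul_antipode_shift_comul_left_inverse :
    𝐦 k (𝛋 (k + 1) (𝛗 (k + 1) (𝐦 k (𝛗 (k + 1) w)))) = w :=
  calc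
    _ = 𝐦 k (𝐦 k (𝛋 (k + 2) (𝛗 (k + 2) (𝛗 (k + 1) w)))) := by simp
    _ = w := by
      rw [← act_comul_comul, act_mul_mul, act_mul_shift_antipode_comul, act_counit_comul,
        act_mul_shift_unit]

theorem mul_antipode_shift_comul_right_inverse :
    𝐦 k (𝛗 (k + 1) (𝐦 k (𝛋 (k + 1) (𝛗 (k + 1) w)))) = w :=
  calc
    _ = 𝐦 k (𝐦 k (𝛋 (k + 1) (𝛗 (k + 2) (𝛗 (k + 1) w)))) := by simp
    _ = w := by
      rw [← act_comul_comul, act_mul_mul, act_mul_antipode_comul, act_counit_comul,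
        act_mul_shift_unit]

theorem shift_mul_antipode_comul_left_inverse :
    𝐦 (k + 1) (𝛋 (k + 1) (𝛗 k (𝐦 (k + 1) (𝛗 k w)))) = w :=
  calc
    _ = 𝐦 (k + 1) (𝐦 (k + 2) (𝛋 (k + 1) (𝛗 k (𝛗 k w)))) := by simp
    _ = w := by
      rw [act_comul_comul, ← act_mul_mul, act_mul_antipode_comul, act_shift_counit_comul,
        act_mul_unit]

theorem shift_mul_antipode_comul_right_inverse :
    𝐦 (k + 1) (𝛗 k (𝐦 (k + 1) (𝛋 (k + 1) (𝛗 k w)))) = w :=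
  calc
    _ = 𝐦 (k + 1) (𝐦 (k + 2) (𝛋 (k + 2) (𝛗 k (𝛗 k w)))) := by simp
    _ = w := by
      rw [act_comul_comul, ← act_mul_mul, act_mul_shift_antipode_comul, act_shift_counit_comul,
        act_mul_unit]

theorem mul_counit_mul_flip_comul_comul :
    𝐦 k (𝛆 k (𝐦 k (𝛔 (k + 1) (𝛗 k (𝛗 (k + 1) w))))) = 𝐦 k w := by
  rw [← act_counit_comul C k (𝐦 k w), act_comul_mul]
  simp

theorem mul_shift_counit_mul_flip_comul_comul :
    𝐦 k (𝛆 (k + 2) (𝐦 (k + 2) (𝛔 (k + 1) (𝛗 (k + 2) (𝛗 k w))))) = 𝐦 k w := by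
  rw [← act_shift_counit_comul C k (𝐦 k w), act_comul_mul]
  simp

theorem counit_mul_shift_flip_comul : 𝛆 k (𝐦 k (𝛔 (k + 1) (𝛗 k w))) = 𝛆 (k + 1) w := by
  symm
  calc
    _ = 𝐦 k (𝐦 k (𝛋 (k + 2) (𝛗 (k + 1) w))) := by
      rw [act_mul_mul, act_mul_shift_antipode_comul, act_mul_shift_unit]
    _ = 𝐦 k (𝛋 (k + 1) (𝐦 k (𝛗 (k + 1) w))) := by simp
    _ = 𝐦 k (𝛋 (k + 1) (𝐦 k (𝛆 k (𝐦 k (𝛔 (k + 1) (𝛗 k (𝛗 (k + 1) (𝛗 (k + 1) w)))))))) := by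
      rw [mul_counit_mul_flip_comul_comul]
    _ = 𝐦 k (𝐦 k (𝛆 k (𝐦 k (𝛔 (k + 1) (𝛗 k (𝛋 (k + 3) (𝛗 (k + 2) (𝛗 (k + 1) w)))))))) := by
      rw [act_comul_comul]; simp
    _ = 𝐦 k (𝛆 k (𝐦 k (𝛔 (k + 1) (𝛗 k (𝐦 (k + 2) (𝛋 (k + 3) (𝛗 (k + 2) (𝛗 (k + 1) w)))))))) := by
      rw [act_mul_mul]; simp
    _ = 𝐦 k (𝛈 (k + 1) (𝛆 k (𝐦 k (𝛔 (k + 1) (𝛗 k (𝛆 (k + 2) (𝛗 (k + 1) w))))))) := by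
      rw [act_mul_shift_antipode_comul]; simp
    _ = 𝛆 k (𝐦 k (𝛔 (k + 1) (𝛗 k w))) := by
      rw [act_mul_shift_unit, act_shift_counit_comul]

theorem shift_counit_mul_flip_shift_comul :
    𝛆 (k + 1) (𝐦 (k + 1) (𝛔 k (𝛗 (k + 1) w))) = 𝛆 k w := by
  symm
  calc
    _ = 𝐦 k (𝐦 k (𝛋 k (𝛗 k w))) := by rw [act_mul_antipode_comul, act_mul_unit]
    _ = 𝐦 k (𝛋 k (𝐦 (k + 1) (𝛗 k w))) := by rw [act_mul_mul]; simp
    _ = 𝐦 k (𝛋 k (𝐦 (k + 1)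
          (𝛆 (k + 3) (𝐦 (k + 3) (𝛔 (k + 2) (𝛗 (k + 3) (𝛗 k (𝛗 k w)))))))) := by
      rw [act_comul_comul, mul_shift_counit_mul_flip_comul_comul C (k + 1)]
    _ = 𝐦 k (𝐦 (k + 1)
          (𝛆 (k + 3) (𝐦 (k + 3) (𝛔 (k + 2) (𝛗 (k + 3) (𝛋 k (𝛗 k (𝛗 k w)))))))) := by simp
    _ = 𝐦 k (𝛆 (k + 2) (𝐦 (k + 2) (𝛔 (k + 1) (𝛗 (k + 2) (𝐦 k (𝛋 k (𝛗 k (𝛗 k w)))))))) := by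
      rw [← act_mul_mul]; simp
    _ = 𝐦 k (𝛆 (k + 2) (𝐦 (k + 2) (𝛔 (k + 1) (𝛗 (k + 2) (𝛈 k w))))) := by
      rw [act_mul_antipode_comul, act_counit_comul]
    _ = 𝐦 k (𝛈 k (𝛆 (k + 1) (𝐦 (k + 1) (𝛔 k (𝛗 (k + 1) w))))) := by simp
    _ = 𝛆 (k + 1) (𝐦 (k + 1) (𝛔 k (𝛗 (k + 1) w))) := act_mul_unit _ _ _

/-! ### The secondary flip -/

theorem shift_comul_flipInv_shift_comul : 𝛗 (k + 1) (𝛔⁻ k (𝛗 (k + 1) w)) =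
    𝛔 (k + 2) (𝛔⁻ k (𝛗 (k + 1) (𝛔⁻ (k + 1) (𝛗 k w)))) := by
  rw [← C.act_flipInv_flip k (𝛗 (k + 1) (𝛔⁻ k (𝛗 (k + 1) w))), act_flip_comul]
  simp

theorem shift_comul_shift_flipInv_comul : 𝛗 (k + 1) (𝛔⁻ (k + 1) (𝛗 k w)) =
    𝛔 k (𝛔⁻ (k + 2) (𝛗 (k + 1) (𝛔⁻ k (𝛗 (k + 1) w)))) := by
  rw [← C.act_flipInv_flip (k + 2) (𝛗 (k + 1) (𝛔⁻ (k + 1) (𝛗 k w))), ← act_flip_comul]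
  simp

/-- `(id² ⊗ ε) (id ⊗ σ⁻¹) (φ ⊗ id)`, the quotient `τ σ⁻¹` of the two flips. -/
def leftRatio : E := C.shift (C.shift C.counit) * C.shift ↑C.flip⁻¹ * C.comul

/-- The secondary flip `τ`. -/
def secondaryFlip : E := C.leftRatio * C.flip

/-- The quotient `σ⁻¹ τ` of the two flips. -/
def rightRatio : E := ↑C.flip⁻¹ * C.secondaryFlip

/-- `(id² ⊗ ε) (id ⊗ σ) (φ ⊗ id)`, which turns out to be the inverse `τ⁻¹ σ` of `rightRatio`. -/
def rightRatioInv : E := C.shift (C.shift C.counit) * C.shift C.flip * C.comul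

local notation "𝛕" => act C (secondaryFlip C)
local notation "𝐋" => act C (leftRatio C)
local notation "𝐑" => act C (rightRatio C)
local notation "𝐑⁻" => act C (rightRatioInv C)

theorem isLocal_leftRatio : IsLocal C.shift 2 2 C.leftRatio :=
  (C.isLocal_counit.shift.shift.mul C.isLocal_flip.units_inv.shift).mul C.isLocal_comul.succ

theorem isLocal_secondaryFlip : IsLocal C.shift 2 2 C.secondaryFlip :=
  C.isLocal_leftRatio.mul C.isLocal_flip

theorem isLocal_rightRatioInv : IsLocal C.shift 2 2 C.rightRatioInv :=
  (C.isLocal_counit.shift.shift.mul C.isLocal_flip.shift).mul C.isLocal_comul.succ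

variable {k} in
theorem act_leftRatio_comm {a : ℕ} (hk : k + 2 ≤ a) (h : E) :
    𝐋 k (C.act h a w) = C.act h a (𝐋 k w) :=
  act_comm C.isLocal_leftRatio hk h w

attribute [local simp] act_leftRatio_comm

theorem act_leftRatio : 𝐋 k w = 𝛆 (k + 2) (𝛔⁻ (k + 1) (𝛗 k w)) := by
  simp [leftRatio]

theorem act_leftRatio_mirror : 𝐋 k w = 𝛆 k (𝛔⁻ k (𝛗 (k + 1) w)) := by
  have h := congrArg (fun v => 𝛆 (k + 1) (𝐦 (k + 1) v)) (C.act_flip_comul k w)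
  simp only [shift_counit_mul_flip_shift_comul, counit_mul_shift_flip_comul] at h
  rw [act_leftRatio, h]

theorem act_secondaryFlip : 𝛕 k w = 𝐋 k (𝛔 k w) := by simp [secondaryFlip]

theorem act_rightRatio : 𝐑 k w = 𝛔⁻ k (𝛕 k w) := by simp [rightRatio]

theorem act_rightRatioInv : 𝐑⁻ k w = 𝛆 (k + 2) (𝛔 (k + 1) (𝛗 k w)) := by
  simp [rightRatioInv]

theorem flip_rightRatio : 𝛔 k (𝐑 k w) = 𝛕 k w := by rw [act_rightRatio, act_flip_flipInv]

theorem comul_leftRatio : 𝛗 k (𝐋 k w) = 𝐋 (k + 1) (𝛗 k w) := by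
  simp [act_leftRatio, act_comul_comul]

theorem shift_comul_leftRatio : 𝛗 (k + 1) (𝐋 k w) = 𝐋 k (𝛗 (k + 1) w) := by
  simp [act_leftRatio_mirror, act_comul_comul]

theorem counit_leftRatio : 𝛆 k (𝐋 k w) = 𝛆 (k + 1) (𝛔⁻ k w) :=
  calc
    _ = 𝛆 (k + 1) (𝛔⁻ k (𝛆 k (𝛗 k w))) := by simp [act_leftRatio]
    _ = _ := by rw [act_counit_comul]

theorem shift_counit_leftRatio : 𝛆 (k + 1) (𝐋 k w) = 𝛆 k (𝛔⁻ k w) :=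
  calc
    _ = 𝛆 k (𝛔⁻ k (𝛆 (k + 2) (𝛗 (k + 1) w))) := by simp [act_leftRatio_mirror]
    _ = _ := by rw [act_shift_counit_comul]

theorem counit_secondaryFlip : 𝛆 k (𝛕 k w) = 𝛆 (k + 1) w := by
  rw [act_secondaryFlip, counit_leftRatio, act_flipInv_flip]

theorem shift_counit_secondaryFlip : 𝛆 (k + 1) (𝛕 k w) = 𝛆 k w := by
  rw [act_secondaryFlip, shift_counit_leftRatio, act_flipInv_flip]

theorem comul_counit_flipInv : 𝛗 k (𝛆 k (𝛔⁻ k w)) = 𝛆 (k + 1) (𝛔⁻ (k + 1) (𝛗 k w)) := by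
  rw [← shift_counit_leftRatio, ← shift_counit_leftRatio, ← comul_leftRatio]
  simp

theorem comul_shift_counit_flipInv :
    𝛗 k (𝛆 (k + 1) (𝛔⁻ k w)) = 𝛆 (k + 1) (𝛔⁻ k (𝛗 (k + 1) w)) := by
  rw [← counit_leftRatio, ← counit_leftRatio, ← shift_comul_leftRatio]
  simp

theorem secondaryFlip_eq_counit_mul : 𝛕 k w = 𝛆 k (𝐦 k (𝛗 (k + 1) (𝛔 (k + 1) (𝛗 k w)))) := by
  have comul_leftRatio_eq (v : E) : 𝛗 k (𝐋 k v) =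
      𝛆 (k + 1) (𝐦 (k + 1) (𝛗 (k + 2) (𝛔 (k + 2) (𝛗 (k + 1) (𝛔⁻ (k + 1) (𝛗 k v)))))) := by
    rw [← act_flip_comul]
    symm
    calc
      _ = 𝛆 (k + 1) (𝐦 (k + 1) (𝛔 k (𝛗 (k + 2) (𝛗 (k + 1) (𝛔⁻ k (𝛗 (k + 1) v)))))) := by simp
      _ = 𝛆 k (𝛗 (k + 1) (𝛔⁻ k (𝛗 (k + 1) v))) := by
        rw [← act_comul_comul, shift_counit_mul_flip_shift_comul]
      _ = _ := by simp [act_leftRatio_mirror]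
  rw [act_secondaryFlip, ← C.act_counit_comul k (𝐋 k _), comul_leftRatio_eq]
  calc
    _ = 𝛆 k (𝐦 k (𝛗 (k + 1) (𝛔 (k + 1) (𝛗 k (𝛔⁻ k (𝛆 k (𝛗 k (𝛔 k w)))))))) := by simp
    _ = _ := by rw [act_counit_comul, act_flipInv_flip]

theorem secondaryFlip_eq_shift_counit_mul :
    𝛕 k w = 𝛆 (k + 2) (𝐦 (k + 2) (𝛗 (k + 1) (𝛔 k (𝛗 (k + 1) w)))) := by
  have shift_comul_leftRatio_eq (v : E) : 𝛗 (k + 1) (𝐋 k v) =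
      𝛆 (k + 2) (𝐦 (k + 2) (𝛗 (k + 1) (𝛔 k (𝛗 (k + 1) (𝛔⁻ k (𝛗 (k + 1) v)))))) := by
    rw [act_flip_comul]
    symm
    calc
      _ = 𝛆 (k + 2) (𝐦 (k + 2) (𝛔 (k + 3) (𝛗 (k + 1) (𝛗 (k + 1) (𝛔⁻ (k + 1) (𝛗 k v)))))) := by
        simp
      _ = 𝛆 (k + 3) (𝛗 (k + 1) (𝛔⁻ (k + 1) (𝛗 k v))) := by
        rw [act_comul_comul, counit_mul_shift_flip_comul]
      _ = _ := by simp [act_leftRatio]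
  rw [act_secondaryFlip, ← C.act_shift_counit_comul (k + 1) (𝐋 k _), shift_comul_leftRatio_eq]
  calc
    _ = 𝛆 (k + 2) (𝐦 (k + 2) (𝛗 (k + 1) (𝛔 k (𝛗 (k + 1)
          (𝛔⁻ k (𝛆 (k + 2) (𝛗 (k + 1) (𝛔 k w)))))))) := by simp
    _ = _ := by rw [act_shift_counit_comul, act_flipInv_flip]

theorem mul_shift_flip_comul_flipInv :
    𝐦 k (𝛔 (k + 1) (𝛗 k (𝛔⁻ k (𝛔⁻ (k + 1) (𝛗 k (𝛔 k w)))))) =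
      𝐦 k (𝛔⁻ (k + 2) (𝛗 (k + 1) (𝛔 (k + 1) (𝛗 k w)))) := by
  have flip_mul_flip_comul_comul (v : E) :
      𝛔 (k + 2) (𝐦 (k + 1) (𝛔 (k + 2) (𝛗 (k + 1)
        (𝛔⁻ (k + 1) (𝛔⁻ (k + 2) (𝛗 (k + 1) (𝛗 k v))))))) =
      𝐦 (k + 1) (𝛗 (k + 2) (𝛔 (k + 2) (𝛗 (k + 1) (𝛔⁻ (k + 1) (𝛗 k v))))) := by
    rw [← act_flip_comul]
    symm
    calc
      _ = 𝐦 (k + 1) (𝛔 k (𝛗 (k + 2) (𝛗 (k + 1) (𝛔⁻ k (𝛗 (k + 1) v))))) := by simp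
      _ = 𝐦 (k + 1) (𝛔 k (𝛗 (k + 1) (𝛔 (k + 2) (𝛔⁻ k
            (𝛗 (k + 1) (𝛔⁻ (k + 1) (𝛗 k v))))))) := by
        rw [← act_comul_comul, shift_comul_flipInv_shift_comul]
      _ = 𝛔 (k + 2) (𝐦 (k + 1) (𝛔 k (𝛗 (k + 1) (𝛔⁻ k
            (𝛗 (k + 1) (𝛔⁻ (k + 1) (𝛗 k v))))))) := by simp
      _ = 𝛔 (k + 2) (𝐦 (k + 1) (𝛔 (k + 2) (𝛗 (k + 1)
            (𝛔⁻ (k + 1) (𝛗 k (𝛔⁻ (k + 1) (𝛗 k v))))))) := by rw [act_flip_comul]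
      _ = _ := by simp [act_comul_comul]
  have h := congrArg (fun v => 𝛆 k (𝛔⁻ (k + 2) v))
    (flip_mul_flip_comul_comul (𝛔 k w))
  simp only [act_flipInv_flip] at h
  calc
    _ = 𝐦 k (𝛔 (k + 1) (𝛗 k (𝛔⁻ k (𝛔⁻ (k + 1) (𝛗 k (𝛆 k (𝛗 k (𝛔 k w)))))))) := by
      rw [act_counit_comul]
    _ = 𝛆 k (𝐦 (k + 1) (𝛔 (k + 2) (𝛗 (k + 1)
          (𝛔⁻ (k + 1) (𝛔⁻ (k + 2) (𝛗 (k + 1) (𝛗 k (𝛔 k w)))))))) := by simp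
    _ = 𝛆 k (𝛔⁻ (k + 2) (𝐦 (k + 1) (𝛗 (k + 2) (𝛔 (k + 2)
          (𝛗 (k + 1) (𝛔⁻ (k + 1) (𝛗 k (𝛔 k w)))))))) := h
    _ = 𝐦 k (𝛔⁻ (k + 2) (𝛗 (k + 1) (𝛔 (k + 1) (𝛗 k (𝛔⁻ k (𝛆 k (𝛗 k (𝛔 k w)))))))) := by
      simp
    _ = _ := by rw [act_counit_comul, act_flipInv_flip]

theorem shift_mul_flip_shift_comul_flipInv :
    𝐦 (k + 2) (𝛔 (k + 1) (𝛗 (k + 2) (𝛔⁻ (k + 1) (𝛔⁻ k (𝛗 (k + 1) (𝛔 k w)))))) =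
      𝐦 (k + 2) (𝛔⁻ k (𝛗 (k + 1) (𝛔 k (𝛗 (k + 1) w)))) := by
  have flip_mul_flip_comul_comul (v : E) :
      𝛔 k (𝐦 (k + 2) (𝛔 (k + 1) (𝛗 (k + 2)
        (𝛔⁻ (k + 1) (𝛔⁻ k (𝛗 (k + 1) (𝛗 (k + 1) v))))))) =
      𝐦 (k + 2) (𝛗 (k + 1) (𝛔 k (𝛗 (k + 1) (𝛔⁻ k (𝛗 (k + 1) v))))) := by
    rw [act_flip_comul]
    symm
    calc
      _ = 𝐦 (k + 2) (𝛔 (k + 3) (𝛗 (k + 1) (𝛗 (k + 1) (𝛔⁻ (k + 1) (𝛗 k v))))) := by simp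
      _ = 𝐦 (k + 2) (𝛔 (k + 3) (𝛗 (k + 2) (𝛔 k (𝛔⁻ (k + 2)
            (𝛗 (k + 1) (𝛔⁻ k (𝛗 (k + 1) v))))))) := by
        rw [act_comul_comul, shift_comul_shift_flipInv_comul]
      _ = 𝛔 k (𝐦 (k + 2) (𝛔 (k + 3) (𝛗 (k + 2) (𝛔⁻ (k + 2)
            (𝛗 (k + 1) (𝛔⁻ k (𝛗 (k + 1) v))))))) := by simp
      _ = 𝛔 k (𝐦 (k + 2) (𝛔 (k + 1) (𝛗 (k + 2)
            (𝛔⁻ (k + 1) (𝛗 (k + 2) (𝛔⁻ k (𝛗 (k + 1) v))))))) := by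
        rw [act_flip_comul C (k + 1)]
      _ = _ := by simp [act_comul_comul]
  have h := congrArg (fun v => 𝛆 (k + 3) (𝛔⁻ k v))
    (flip_mul_flip_comul_comul (𝛔 k w))
  simp only [act_flipInv_flip] at h
  calc
    _ = 𝐦 (k + 2) (𝛔 (k + 1) (𝛗 (k + 2) (𝛔⁻ (k + 1) (𝛔⁻ k
          (𝛗 (k + 1) (𝛆 (k + 2) (𝛗 (k + 1) (𝛔 k w)))))))) := by rw [act_shift_counit_comul]
    _ = 𝛆 (k + 3) (𝐦 (k + 2) (𝛔 (k + 1) (𝛗 (k + 2)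
          (𝛔⁻ (k + 1) (𝛔⁻ k (𝛗 (k + 1) (𝛗 (k + 1) (𝛔 k w)))))))) := by simp
    _ = 𝛆 (k + 3) (𝛔⁻ k (𝐦 (k + 2) (𝛗 (k + 1) (𝛔 k
          (𝛗 (k + 1) (𝛔⁻ k (𝛗 (k + 1) (𝛔 k w)))))))) := h
    _ = 𝐦 (k + 2) (𝛔⁻ k (𝛗 (k + 1) (𝛔 k
          (𝛗 (k + 1) (𝛔⁻ k (𝛆 (k + 2) (𝛗 (k + 1) (𝛔 k w)))))))) := by simp
    _ = _ := by rw [act_shift_counit_comul, act_flipInv_flip]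

theorem flipInv_shift_flipInv_comul : 𝛔⁻ k (𝛔⁻ (k + 1) (𝛗 k w)) =
    𝛆 (k + 2) (𝛔⁻ (k + 2) (𝛗 (k + 1) (𝛔⁻ k (𝛗 (k + 1) w)))) := by
  rw [shift_comul_flipInv_shift_comul, act_flipInv_flip]
  calc
    _ = 𝛔⁻ k (𝛆 (k + 2) (𝛗 (k + 1) (𝛔⁻ (k + 1) (𝛗 k w)))) := by rw [act_shift_counit_comul]
    _ = _ := by simp

theorem shift_flipInv_flipInv_shift_comul : 𝛔⁻ (k + 1) (𝛔⁻ k (𝛗 (k + 1) w)) =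
    𝛆 (k + 1) (𝛔⁻ k (𝛗 (k + 1) (𝛔⁻ (k + 1) (𝛗 k w)))) := by
  rw [shift_comul_shift_flipInv_comul, act_flipInv_flip]
  calc
    _ = 𝛔⁻ (k + 1) (𝛆 (k + 1) (𝛗 (k + 1) (𝛔⁻ k (𝛗 (k + 1) w)))) := by rw [act_counit_comul]
    _ = _ := by simp

theorem shift_comul_flipInv_shift_flipInv_comul :
    𝛗 (k + 2) (𝛔⁻ k (𝛔⁻ (k + 1) (𝛗 k w))) = 𝛗 (k + 1) (𝛔⁻ k (𝛔⁻ (k + 1) (𝛗 k w))) := by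
  rw [flipInv_shift_flipInv_comul, comul_counit_flipInv, ← act_comul_comul]
  simp

theorem comul_shift_flipInv_flipInv_shift_comul :
    𝛗 k (𝛔⁻ (k + 1) (𝛔⁻ k (𝛗 (k + 1) w))) =
      𝛗 (k + 1) (𝛔⁻ (k + 1) (𝛔⁻ k (𝛗 (k + 1) w))) := by
  rw [shift_flipInv_flipInv_shift_comul, comul_shift_counit_flipInv, act_comul_comul]
  simp

theorem shift_counit_flipInv_shift_flipInv_comul :
    𝛆 (k + 1) (𝛔⁻ k (𝛔⁻ (k + 1) (𝛗 k (𝛔 k w)))) = 𝐑 k w := by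
  have h := congrArg (𝛆 k) (C.mul_shift_flip_comul_flipInv k w)
  rw [counit_mul_shift_flip_comul] at h
  rw [h, act_rightRatio, secondaryFlip_eq_counit_mul]
  simp

theorem shift_counit_shift_flipInv_flipInv_comul :
    𝛆 (k + 1) (𝛔⁻ (k + 1) (𝛔⁻ k (𝛗 (k + 1) (𝛔 k w)))) = 𝐑 k w := by
  have h := congrArg (𝛆 (k + 2)) (C.shift_mul_flip_shift_comul_flipInv k w)
  rw [shift_counit_mul_flip_shift_comul] at h
  rw [h, act_rightRatio, secondaryFlip_eq_shift_counit_mul]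
  simp

theorem shift_comul_rightRatio_eq : 𝛗 (k + 1) (𝐑 k w) = 𝛔⁻ k (𝛔⁻ (k + 1) (𝛗 k (𝛔 k w))) :=
  calc
    _ = 𝛆 (k + 1) (𝛗 (k + 2) (𝛔⁻ k (𝛔⁻ (k + 1) (𝛗 k (𝛔 k w))))) := by
      rw [← shift_counit_flipInv_shift_flipInv_comul]
      simp
    _ = _ := by rw [shift_comul_flipInv_shift_flipInv_comul, act_counit_comul]

theorem comul_rightRatio_eq : 𝛗 k (𝐑 k w) = 𝛔⁻ (k + 1) (𝛔⁻ k (𝛗 (k + 1) (𝛔 k w))) :=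
  calc
    _ = 𝛆 (k + 2) (𝛗 k (𝛔⁻ (k + 1) (𝛔⁻ k (𝛗 (k + 1) (𝛔 k w))))) := by
      rw [← shift_counit_shift_flipInv_flipInv_comul]
      simp
    _ = _ := by rw [comul_shift_flipInv_flipInv_shift_comul, act_shift_counit_comul]

theorem mul_shift_flip : 𝐦 k (𝛔 (k + 1) w) = 𝛔 k (𝐦 (k + 1) (𝛔⁻ k w)) := by
  rw [act_flip_shift_mul, act_flip_flipInv]

theorem shift_mul_flip : 𝐦 (k + 1) (𝛔 k w) = 𝛔 k (𝐦 k (𝛔⁻ (k + 1) w)) := by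
  rw [act_flip_mul, act_flip_flipInv]

theorem comul_rightRatio : 𝛗 k (𝐑 k w) = 𝐑 (k + 1) (𝛗 k w) := by
  have h : 𝐦 k (𝛔 (k + 1) (𝛗 k (𝛗 (k + 1) (𝐑 k w)))) =
      𝐦 k (𝛔 (k + 1) (𝛗 (k + 2) (𝐑 (k + 1) (𝛗 k w)))) := by
    rw [shift_comul_rightRatio_eq, mul_shift_flip_comul_flipInv,
      shift_comul_rightRatio_eq C (k + 1), act_flip_flipInv]
  rw [mul_shift_flip, mul_shift_flip] at h
  have h' : 𝐦 (k + 1) (𝛗 (k + 2) (𝛔⁻ k (𝛗 k (𝐑 k w)))) =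
      𝐦 (k + 1) (𝛗 (k + 2) (𝛔⁻ k (𝐑 (k + 1) (𝛗 k w)))) := by
    simpa [act_flipInv_flip] using congrArg (𝛔⁻ k) h
  simpa only [mul_antipode_shift_comul_left_inverse C (k + 1), act_flip_flipInv] using
    congrArg (fun v => 𝛔 k (𝐦 (k + 1) (𝛋 (k + 2) (𝛗 (k + 2) v)))) h'

theorem shift_comul_rightRatio : 𝛗 (k + 1) (𝐑 k w) = 𝐑 k (𝛗 (k + 1) w) := by
  have h : 𝐦 (k + 2) (𝛔 (k + 1) (𝛗 (k + 2) (𝛗 k (𝐑 k w)))) =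
      𝐦 (k + 2) (𝛔 (k + 1) (𝛗 k (𝐑 k (𝛗 (k + 1) w)))) := by
    rw [comul_rightRatio_eq, comul_rightRatio_eq, shift_mul_flip_shift_comul_flipInv,
      act_flip_flipInv]
  rw [shift_mul_flip, shift_mul_flip] at h
  have h' : 𝐦 (k + 1) (𝛗 k (𝛔⁻ (k + 1) (𝛗 (k + 1) (𝐑 k w)))) =
      𝐦 (k + 1) (𝛗 k (𝛔⁻ (k + 1) (𝐑 k (𝛗 (k + 1) w)))) := by
    simpa [act_flipInv_flip] using congrArg (𝛔⁻ (k + 1)) h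
  simpa only [shift_mul_antipode_comul_left_inverse, act_flip_flipInv] using
    congrArg (fun v => 𝛔 (k + 1) (𝐦 (k + 1) (𝛋 (k + 1) (𝛗 k v)))) h'

theorem comul_flip_eq_flip_secondaryFlip : 𝛗 k (𝛔 k w) = 𝛔 (k + 1) (𝛕 k (𝛗 (k + 1) w)) := by
  rw [← flip_rightRatio, ← shift_comul_rightRatio, shift_comul_rightRatio_eq, act_flip_flipInv,
    act_flip_flipInv]

theorem shift_comul_flip_eq_flip_secondaryFlip : 𝛗 (k + 1) (𝛔 k w) = 𝛔 k (𝛕 (k + 1) (𝛗 k w)) := by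
  rw [← flip_rightRatio, ← comul_rightRatio, comul_rightRatio_eq, act_flip_flipInv,
    act_flip_flipInv]

theorem rightRatioInv_rightRatio : 𝐑⁻ k (𝐑 k w) = w := by
  rw [act_rightRatioInv, comul_rightRatio_eq, act_flip_flipInv]
  calc
    _ = 𝛔⁻ k (𝛆 (k + 2) (𝛗 (k + 1) (𝛔 k w))) := by simp
    _ = w := by rw [act_shift_counit_comul, act_flipInv_flip]

theorem comul_rightRatioInv : 𝛗 k (𝐑⁻ k w) = 𝐑⁻ (k + 1) (𝛗 k w) := by
  simp [act_rightRatioInv, act_comul_comul]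

theorem counit_rightRatio : 𝛆 k (𝐑 k w) = 𝛆 k (𝐦 k (𝛗 (k + 1) w)) :=
  calc
    _ = 𝛆 k (𝛔⁻ k (𝛆 k (𝐦 k (𝛗 (k + 1) (𝛔 (k + 1) (𝛗 k w)))))) := by
      rw [act_rightRatio, secondaryFlip_eq_counit_mul]
    _ = 𝛆 k (𝛆 k (𝐦 k (𝛔⁻ (k + 2) (𝛗 (k + 1) (𝛔 (k + 1) (𝛗 k w)))))) := by simp
    _ = 𝛆 k (𝛆 k (𝐦 k (𝛕 (k + 1) (𝛗 (k + 2) (𝛗 k w))))) := by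
      rw [comul_flip_eq_flip_secondaryFlip, act_flipInv_flip]
    _ = 𝛆 k (𝐦 k (𝛆 (k + 2) (𝛕 (k + 1) (𝛗 (k + 2) (𝛗 k w))))) := by simp
    _ = 𝛆 k (𝐦 k (𝛗 (k + 1) (𝛆 (k + 1) (𝛗 k w)))) := by
      rw [shift_counit_secondaryFlip]; simp
    _ = _ := by rw [act_shift_counit_comul]

theorem rightRatio_rightRatioInv : 𝐑 k (𝐑⁻ k w) = w := by
  have h (j : ℕ) (v : E) : 𝛆 j (𝐑 j (𝐑⁻ j v)) = 𝛆 j v := by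
    rw [counit_rightRatio, ← C.shift_counit_secondaryFlip j v,
      secondaryFlip_eq_counit_mul]
    simp [act_rightRatioInv]
  rw [← C.act_shift_counit_comul k (𝐑 k (𝐑⁻ k w)), comul_rightRatio, comul_rightRatioInv, h,
    act_shift_counit_comul]

theorem secondaryFlip_rightRatioInv : 𝛕 k (𝐑⁻ k w) = 𝛔 k w := by
  rw [← flip_rightRatio, rightRatio_rightRatioInv]

theorem shift_comul_rightRatioInv : 𝛗 (k + 1) (𝐑⁻ k w) = 𝐑⁻ k (𝛗 (k + 1) w) := by
  rw [← C.rightRatioInv_rightRatio k (𝛗 (k + 1) (𝐑⁻ k w)), ← shift_comul_rightRatio,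
    rightRatio_rightRatioInv]

theorem leftRatio_mul : 𝐋 k (𝐦 k w) = 𝐦 k (𝛕 (k + 1) (𝐋 k (𝛔⁻ (k + 1) w))) := by
  have flipInv_mul (v : E) : 𝛔⁻ k (𝐦 k v) = 𝐦 (k + 1) (𝛔⁻ k (𝛔⁻ (k + 1) v)) := by
    rw [← C.act_flipInv_flip k (𝐦 (k + 1) _), act_flip_shift_mul, act_flip_flipInv,
      act_flip_flipInv]
  have flipInv_shift_comul (v : E) :
      𝛔⁻ (k + 1) (𝛗 (k + 2) v) = 𝛕 (k + 2) (𝛗 (k + 1) (𝛔⁻ (k + 1) v)) := by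
    rw [← C.act_flipInv_flip (k + 1) (𝛕 (k + 2) _), ← shift_comul_flip_eq_flip_secondaryFlip,
      act_flip_flipInv]
  calc
    _ = 𝛆 k (𝛔⁻ k (𝐦 k (𝛗 (k + 2) w))) := by simp [act_leftRatio_mirror]
    _ = 𝛆 k (𝐦 (k + 1) (𝛔⁻ k (𝛕 (k + 2) (𝛗 (k + 1) (𝛔⁻ (k + 1) w))))) := by
      rw [flipInv_mul, flipInv_shift_comul]
    _ = _ := by simp [act_leftRatio_mirror]

theorem leftRatio_injective {v w : E} (h : 𝐋 k v = 𝐋 k w) : v = w := by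
  have left_inverse (v : E) : 𝛔 k (𝐑⁻ k (𝛔⁻ k (𝐋 k v))) = v := by
    rw [← C.act_flip_flipInv k v, ← act_secondaryFlip, ← act_rightRatio,
      rightRatioInv_rightRatio]
  rw [← left_inverse v, h, left_inverse]

/-- The flip `σ τ⁻¹ σ`, the reflection of `τ` in `σ`. -/
def reflectedFlip : E := C.flip * C.rightRatioInv

local notation "𝛖" => act C (reflectedFlip C)

theorem act_reflectedFlip : 𝛖 k w = 𝛔 k (𝐑⁻ k w) := by simp [reflectedFlip]

theorem leftRatio_reflectedFlip : 𝐋 k (𝛖 k w) = 𝛔 k w := by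
  rw [act_reflectedFlip, ← act_secondaryFlip, secondaryFlip_rightRatioInv]

theorem secondaryFlip_shift_mul : 𝛕 k (𝐦 (k + 1) w) = 𝐦 k (𝛕 (k + 1) (𝛕 k w)) := by
  rw [act_secondaryFlip, act_flip_shift_mul, leftRatio_mul, act_flipInv_flip,
    ← act_secondaryFlip]

theorem reflectedFlip_shift_mul : 𝛖 k (𝐦 (k + 1) w) = 𝐦 k (𝛖 (k + 1) (𝛖 k w)) := by
  have leftRatio_shift_rightRatioInv (v : E) : 𝐋 k (𝐑⁻ (k + 1) v) = 𝐑⁻ (k + 1) (𝐋 k v) := by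
    rw [act_rightRatioInv, act_rightRatioInv, shift_comul_leftRatio]
    simp
  apply C.leftRatio_injective k
  rw [leftRatio_reflectedFlip, act_flip_shift_mul, leftRatio_mul, act_reflectedFlip C (k + 1),
    act_flipInv_flip, leftRatio_shift_rightRatioInv, secondaryFlip_rightRatioInv,
    leftRatio_reflectedFlip]

theorem comul_secondaryFlip : 𝛗 k (𝛕 k w) = 𝛕 (k + 1) (𝛕 k (𝛗 (k + 1) w)) := by
  rw [act_secondaryFlip, comul_leftRatio, comul_flip_eq_flip_secondaryFlip, ← act_secondaryFlip]

theorem comul_reflectedFlip : 𝛗 k (𝛖 k w) = 𝛔 (k + 1) (𝛔 k (𝛗 (k + 1) w)) := by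
  rw [act_reflectedFlip, comul_flip_eq_flip_secondaryFlip, shift_comul_rightRatioInv,
    secondaryFlip_rightRatioInv]

theorem comul_flip_eq_secondaryFlip_flip : 𝛗 k (𝛔 k w) = 𝛕 (k + 1) (𝛔 k (𝛗 (k + 1) w)) := by
  rw [act_secondaryFlip, ← comul_reflectedFlip, ← comul_leftRatio, leftRatio_reflectedFlip]

/-! ### Crossings -/

/-- A crossing of two strands past which products and the unit of the second strand can be slid.
Only right invertibility is asked for, which is enough for the unit. -/
structure IsCrossing (a : E) : Prop where
  isLocal : IsLocal C.shift 2 2 a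
  shift_mul : a * C.shift C.mul = C.mul * C.shift a * a
  exists_right_inverse : ∃ a', a * a' = 1

variable {C}

namespace IsCrossing

variable {a : E} (ha : C.IsCrossing a)

include ha

theorem act_comm {k n : ℕ} (hk : k + 2 ≤ n) (h w : E) :
    C.act a k (C.act h n w) = C.act h n (C.act a k w) :=
  BraidedCalculus.act_comm ha.isLocal hk h w

theorem act_shift_mul : C.act a k (𝐦 (k + 1) w) = 𝐦 k (C.act a (k + 1) (C.act a k w)) := by
  simpa using C.act_congr k w ha.shift_mul

theorem act_shift_unit : C.act a k (𝛈 (k + 1) w) = 𝛈 k w := by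
  obtain ⟨a', ha'⟩ := ha.exists_right_inverse
  have act_right_inverse (v : E) : C.act a k (C.act a' k v) = v := by
    simpa using C.act_congr k v ha'
  symm
  calc
    _ = C.act a k (𝐦 (k + 1) (𝛈 (k + 2) (C.act a' k (𝛈 k w)))) := by
      rw [act_mul_shift_unit, act_right_inverse]
    _ = 𝐦 k (C.act a (k + 1) (𝛈 (k + 2) (𝛈 k w))) := by
      rw [ha.act_shift_mul, ha.act_comm le_rfl, act_right_inverse]
    _ = 𝐦 k (𝛈 k (C.act a k (𝛈 (k + 1) w))) := by simp
    _ = _ := act_mul_unit _ _ _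

end IsCrossing

theorem isCrossing_flip : C.IsCrossing C.flip :=
  ⟨C.isLocal_flip, C.flip_shift_mul, _, C.flip.mul_inv⟩

theorem isCrossing_secondaryFlip : C.IsCrossing C.secondaryFlip where
  isLocal := C.isLocal_secondaryFlip
  shift_mul := C.ext fun w => by simp [secondaryFlip_shift_mul]
  exists_right_inverse := ⟨C.rightRatioInv * ↑C.flip⁻¹, C.ext fun w => by
    simp [secondaryFlip_rightRatioInv, act_flip_flipInv]⟩

theorem isCrossing_reflectedFlip : C.IsCrossing C.reflectedFlip where
  isLocal := C.isLocal_flip.mul C.isLocal_rightRatioInv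
  shift_mul := C.ext fun w => by simp [reflectedFlip_shift_mul]
  exists_right_inverse := ⟨C.rightRatio * ↑C.flip⁻¹, C.ext fun w => by
    simp [act_reflectedFlip, rightRatioInv_rightRatio, act_flip_flipInv]⟩

theorem eq_of_mul_shift_eq {a f g : E} (ha : C.IsCrossing a)
    (h : C.mul * C.shift f * a * C.shift C.comul = C.mul * C.shift g * a * C.shift C.comul) :
    f = g := by
  have act_h (v : E) :
      𝐦 1 (C.act f 2 (C.act a 1 (𝛗 2 v))) = 𝐦 1 (C.act g 2 (C.act a 1 (𝛗 2 v))) := by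
    simpa using C.act_congr 1 v h
  have mul_comul (f v : E) : 𝐦 0 (C.act f 1 (C.act a 0 (𝐦 1 (𝛗 2 v)))) =
      𝐦 0 (𝐦 1 (C.act f 2 (C.act a 1 (𝛗 2 (C.act a 0 v))))) := by
    rw [← act_mul_mul, ha.act_shift_mul, ha.act_comm le_rfl]
    simp
  have mul_unit (f v : E) : 𝐦 0 (C.act f 1 (𝛈 0 v)) = C.act f 0 v := by
    rw [← C.act_mul_unit 0 (C.act f 0 v)]
    simp
  refine C.ext fun w => ?_
  have := mul_comul f (𝐦 1 (𝛋 2 (𝛗 2 (𝛈 1 w))))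
  rwa [act_h, ← mul_comul, C.mul_antipode_shift_comul_right_inverse 1, ha.act_shift_unit,
    mul_unit, mul_unit] at this

theorem eq_of_shift_mul_eq {b f g : E} (hb : C.IsCrossing b) (hf : IsLocal C.shift 3 3 f)
    (hg : IsLocal C.shift 3 3 g)
    (h : C.shift C.mul * C.shift (C.shift b) * f * C.shift (C.shift C.comul) =
      C.shift C.mul * C.shift (C.shift b) * g * C.shift (C.shift C.comul)) : f = g := by
  have act_h (v : E) :
      𝐦 1 (C.act b 2 (C.act f 0 (𝛗 2 v))) = 𝐦 1 (C.act b 2 (C.act g 0 (𝛗 2 v))) := by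
    simpa using C.act_congr 0 v h
  have mul_comul {f : E} (hf : IsLocal C.shift 3 3 f) (v : E) :
      𝐦 1 (C.act b 2 (C.act f 0 (𝐦 3 (𝛗 2 v)))) =
        𝐦 1 (C.act b 2 (𝐦 1 (C.act b 2 (C.act f 0 (𝛗 2 v))))) := by
    rw [act_comm hf le_rfl, hb.act_shift_mul, ← act_mul_mul]
    simp
  have mul_unit {f : E} (hf : IsLocal C.shift 3 3 f) (v : E) :
      𝐦 1 (C.act b 2 (C.act f 0 (𝛈 3 v))) = C.act f 0 v := by
    rw [act_comm hf le_rfl, hb.act_shift_unit, act_mul_shift_unit]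
  refine C.ext fun w => ?_
  rw [← mul_unit hf, ← mul_unit hg, ← C.shift_mul_antipode_comul_right_inverse 2 (𝛈 3 w),
    mul_comul hf, mul_comul hg, act_h]

theorem flip_mul_crossings {a b c : E} (ha : C.IsCrossing a) (hb : C.IsCrossing b)
    (hc : C.IsCrossing c)
    (hcomul : ∀ k w, 𝛗 k (C.act c k w) = C.act b (k + 1) (C.act a k (𝛗 (k + 1) w))) :
    C.flip * C.shift a * b = C.shift b * a * C.shift C.flip := by
  -- After composition with canonical maps both sides become `φ c (id ⊗ m)`.
  refine eq_of_shift_mul_eq hb ((C.isLocal_flip.succ.mul ha.isLocal.shift).mul hb.isLocal.succ)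
    ((hb.isLocal.shift.mul ha.isLocal.succ).mul C.isLocal_flip.shift)
    (eq_of_mul_shift_eq ha (C.ext fun w => ?_))
  simp only [act_mul, act_shift, zero_add, Nat.reduceAdd]
  have comm_a {k n} (hk : k + 2 ≤ n) := ha.act_comm hk
  have comm_b {k n} (hk : k + 2 ≤ n) := hb.act_comm hk
  have comm_c {k n} (hk : k + 2 ≤ n) := hc.act_comm hk
  symm
  calc
    _ = 𝐦 0 (𝐦 2 (C.act b 3 (C.act b 2 (C.act a 1 (C.act a 0 (𝛔 2 (𝛗 1 (𝛗 2 w)))))))) := by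
      simp [comm_a]
    _ = 𝐦 0 (C.act b 2 (𝐦 3 (C.act a 1 (C.act a 0 (𝛔 2 (𝛗 1 (𝛗 2 w))))))) := by
      rw [hb.act_shift_mul]
    _ = C.act b 1 (𝐦 0 (C.act a 1 (C.act a 0 (𝐦 3 (𝛔 2 (𝛗 1 (𝛗 2 w))))))) := by
      simp [comm_a]
    _ = 𝛗 0 (C.act c 0 (𝐦 1 w)) := by rw [hcomul, act_comul_mul, ha.act_shift_mul]
    _ = 𝐦 0 (𝐦 2 (𝛔 1 (𝛗 0 (C.act b 2 (C.act a 1 (𝛗 2 (C.act c 0 w))))))) := by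
      rw [hc.act_shift_mul, act_comul_mul, hcomul]
    _ = 𝐦 0 (𝐦 2 (𝛔 1 (C.act b 3 (C.act a 2 (𝛗 0 (C.act c 0 (𝛗 2 w))))))) := by
      simp [comm_c]
    _ = 𝐦 0 (𝐦 2 (𝛔 1 (C.act b 3 (C.act a 2 (C.act b 1 (C.act a 0 (𝛗 1 (𝛗 2 w)))))))) := by
      rw [hcomul]
    _ = _ := by simp [comm_a, comm_b]

theorem leftRatio_mul_crossings {a b : E} (ha : C.IsCrossing a) (hb : C.IsCrossing b)
    (hcomul : ∀ k w, 𝛗 k (C.act b k w) = 𝛕 (k + 1) (C.act b k (𝛗 (k + 1) w)))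
    (hflip : C.flip * C.shift C.secondaryFlip * a = C.shift a * C.secondaryFlip * C.shift C.flip) :
    C.leftRatio * C.shift a * b = C.shift a * b * C.shift C.leftRatio := C.ext fun w => by
  have slide (v : E) : 𝛔⁻ 1 (C.act a 2 (𝛕 1 v)) = 𝛕 2 (C.act a 1 (𝛔⁻ 2 v)) := by
    have := C.act_congr 1 (𝛔⁻ 2 v) hflip
    simp only [act_mul, act_shift, Nat.reduceAdd, act_flip_flipInv] at this
    rw [← this, act_flipInv_flip]
  have comm_a {k n} (hk : k + 2 ≤ n) := ha.act_comm hk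
  have comm_b {k n} (hk : k + 2 ≤ n) := hb.act_comm hk
  simp only [act_mul, act_shift, zero_add]
  calc
    _ = 𝛆 2 (𝛔⁻ 1 (C.act a 2 (𝛗 0 (C.act b 0 w)))) := by simp [act_leftRatio]
    _ = 𝛆 3 (C.act a 1 (𝛔⁻ 2 (C.act b 0 (𝛗 1 w)))) := by
      rw [hcomul, slide, counit_secondaryFlip]
    _ = _ := by simp [act_leftRatio, comm_a, comm_b]

variable (C) in
/-- The two flips `σ` and `τ`. -/
def flips : Set E := {↑C.flip, C.secondaryFlip}

theorem flip_mem_flips : ↑C.flip ∈ C.flips := Or.inl rfl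

theorem secondaryFlip_mem_flips : C.secondaryFlip ∈ C.flips := Or.inr rfl

theorem isCrossing_of_mem_flips {a : E} (ha : a ∈ C.flips) : C.IsCrossing a := by
  obtain rfl | rfl := ha
  exacts [isCrossing_flip, isCrossing_secondaryFlip]

theorem exists_isCrossing_comul_eq {a b : E} (ha : a ∈ C.flips) (hb : b ∈ C.flips) :
    ∃ c, C.IsCrossing c ∧
      ∀ k w, 𝛗 k (C.act c k w) = C.act b (k + 1) (C.act a k (𝛗 (k + 1) w)) := by
  obtain rfl | rfl := ha <;> obtain rfl | rfl := hb
  · exact ⟨_, isCrossing_reflectedFlip, C.comul_reflectedFlip⟩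
  · exact ⟨_, isCrossing_flip, C.comul_flip_eq_secondaryFlip_flip⟩
  · exact ⟨_, isCrossing_flip, C.comul_flip_eq_flip_secondaryFlip⟩
  · exact ⟨_, isCrossing_secondaryFlip, C.comul_secondaryFlip⟩

theorem comul_of_mem_flips {b : E} (hb : b ∈ C.flips) (k : ℕ) (w : E) :
    𝛗 k (C.act b k w) = 𝛕 (k + 1) (C.act b k (𝛗 (k + 1) w)) := by
  obtain rfl | rfl := hb
  exacts [C.comul_flip_eq_secondaryFlip_flip k w, C.comul_secondaryFlip k w]

theorem flip_mul_flips {a b : E} (ha : a ∈ C.flips) (hb : b ∈ C.flips) :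
    C.flip * C.shift a * b = C.shift b * a * C.shift C.flip := by
  obtain ⟨c, hc, hcomul⟩ := exists_isCrossing_comul_eq ha hb
  exact flip_mul_crossings (isCrossing_of_mem_flips ha) (isCrossing_of_mem_flips hb) hc hcomul

theorem secondaryFlip_mul_flips {a b : E} (ha : a ∈ C.flips) (hb : b ∈ C.flips) :
    C.secondaryFlip * C.shift a * b = C.shift b * a * C.shift C.secondaryFlip := by
  have hleftRatio := leftRatio_mul_crossings (isCrossing_of_mem_flips hb)
    (isCrossing_of_mem_flips ha) (comul_of_mem_flips ha)
    (flip_mul_flips secondaryFlip_mem_flips hb)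
  calc
    _ = C.leftRatio * (C.flip * C.shift a * b) := by simp only [secondaryFlip, mul_assoc]
    _ = C.leftRatio * C.shift b * a * C.shift C.flip := by
      rw [flip_mul_flips ha hb]
      simp only [mul_assoc]
    _ = _ := by
      rw [hleftRatio]
      simp only [secondaryFlip, map_mul, mul_assoc]

theorem braid {a b c : E} (ha : a ∈ C.flips) (hb : b ∈ C.flips) (hc : c ∈ C.flips) :
    a * C.shift b * c = C.shift c * b * C.shift a := by
  obtain rfl | rfl := ha
  exacts [flip_mul_flips hb hc, secondaryFlip_mul_flips hb hc]

end BraidedCalculus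

noncomputable section

/-! ### Maps between tensor powers as elements of an algebra -/

section Implements

variable {R E : Type*} [CommSemiring R] [Semiring E] [Algebra R E]
variable {X Y Z X' Y' : Type*} [AddCommMonoid X] [AddCommMonoid Y] [AddCommMonoid Z]
  [AddCommMonoid X'] [AddCommMonoid Y']
  [Module R X'] [Module R Y'] [Module R X] [Module R Y] [Module R Z]

/-- `f ⊗ id` on `X ⊗ (Y ⊗ N)`, for a map `f : X ⊗ Y → Z`. -/
def mergeTensor (N : Type*) [AddCommMonoid N] [Module R N] (f : X ⊗[R] Y →ₗ[R] Z) :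
    X ⊗[R] (Y ⊗[R] N) →ₗ[R] Z ⊗[R] N :=
  f.rTensor N ∘ₗ (TensorProduct.assoc R X Y N).symm.toLinearMap

/-- `f ⊗ id` on `X ⊗ N`, for a map `f : X → Y ⊗ Z`. -/
def splitTensor (N : Type*) [AddCommMonoid N] [Module R N] (f : X →ₗ[R] Y ⊗[R] Z) :
    X ⊗[R] N →ₗ[R] Y ⊗[R] (Z ⊗[R] N) :=
  (TensorProduct.assoc R Y Z N).toLinearMap ∘ₗ f.rTensor N

/-- `f ⊗ id` on `X ⊗ (Y ⊗ N)`, for a map `f : X ⊗ Y → X' ⊗ Y'`. -/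
def pairTensor (N : Type*) [AddCommMonoid N] [Module R N] (f : X ⊗[R] Y →ₗ[R] X' ⊗[R] Y') :
    X ⊗[R] (Y ⊗[R] N) →ₗ[R] X' ⊗[R] (Y' ⊗[R] N) :=
  (TensorProduct.assoc R X' Y' N).toLinearMap ∘ₗ f.rTensor N ∘ₗ
    (TensorProduct.assoc R X Y N).symm.toLinearMap

/-- The map `x ⊗ y ↦ i x * j y`, by which maps `i` and `j` into an algebra `E` extend to the tensor
product. -/
def tensorMul (i : X →ₗ[R] E) (j : Y →ₗ[R] E) : X ⊗[R] Y →ₗ[R] E :=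
  LinearMap.mul' R E ∘ₗ TensorProduct.map i j

local infixr:70 " ⋆ " => tensorMul

@[simp]
theorem tensorMul_tmul (i : X →ₗ[R] E) (j : Y →ₗ[R] E) (x : X) (y : Y) :
    (i ⋆ j) (x ⊗ₜ y) = i x * j y := rfl

theorem tensorMul_assoc (i : X →ₗ[R] E) (j : Y →ₗ[R] E) (k : Z →ₗ[R] E) :
    (i ⋆ j ⋆ k) ∘ₗ (TensorProduct.assoc R X Y Z).toLinearMap = (i ⋆ j) ⋆ k := by
  ext
  simp [mul_assoc]

/-- Left multiplication by `g ∈ E` induces the map `f`, where `X` and `Y` are mapped to `E` by `i`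
and `j`. -/
def Implements (i : X →ₗ[R] E) (j : Y →ₗ[R] E) (f : X →ₗ[R] Y) (g : E) : Prop :=
  LinearMap.mulLeft R g ∘ₗ i = j ∘ₗ f

namespace Implements

variable {i : X →ₗ[R] E} {j : Y →ₗ[R] E} {k : Z →ₗ[R] E} {f : X →ₗ[R] Y} {g : E}

theorem apply (h : Implements i j f g) (x : X) : g * i x = j (f x) := LinearMap.congr_fun h x

theorem of_apply (h : ∀ x, g * i x = j (f x)) : Implements i j f g := LinearMap.ext h

theorem comp {f' : Y →ₗ[R] Z} {g' : E} (h' : Implements j k f' g') (h : Implements i j f g) :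
    Implements i k (f' ∘ₗ f) (g' * g) :=
  of_apply fun x => by rw [mul_assoc, h.apply, h'.apply, LinearMap.comp_apply]

theorem injective {f' : X →ₗ[R] Y} (hj : Function.Injective j) (h : Implements i j f g)
    (h' : Implements i j f' g) : f = f' :=
  LinearMap.ext fun x => hj ((h.apply x).symm.trans (h'.apply x))

theorem rTensor (h : Implements i j f g) (k : Z →ₗ[R] E) :
    Implements (i ⋆ k) (j ⋆ k) (f.rTensor Z) g :=
  TensorProduct.ext' fun x z => by simp [← mul_assoc, h.apply]

theorem assoc (i : X →ₗ[R] E) (j : Y →ₗ[R] E) (k : Z →ₗ[R] E) :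
    Implements ((i ⋆ j) ⋆ k) (i ⋆ j ⋆ k) (TensorProduct.assoc R X Y Z).toLinearMap 1 := by
  rw [Implements, tensorMul_assoc, LinearMap.mulLeft_one, LinearMap.id_comp]

theorem assoc_symm (i : X →ₗ[R] E) (j : Y →ₗ[R] E) (k : Z →ₗ[R] E) :
    Implements (i ⋆ j ⋆ k) ((i ⋆ j) ⋆ k) (TensorProduct.assoc R X Y Z).symm.toLinearMap 1 :=
  of_apply fun x => by simp [← tensorMul_assoc]

theorem one (i : X →ₗ[R] E) : Implements i i .id 1 := of_apply fun x => one_mul (i x)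

theorem merge {f : X ⊗[R] Y →ₗ[R] Z} (h : Implements (i ⋆ j) k f g) (l : X' →ₗ[R] E) :
    Implements (i ⋆ j ⋆ l) (k ⋆ l) (mergeTensor X' f) g := by
  simpa only [mul_one, mergeTensor] using (h.rTensor l).comp (assoc_symm i j l)

theorem split {f : X →ₗ[R] Y ⊗[R] Z} (h : Implements i (j ⋆ k) f g) (l : X' →ₗ[R] E) :
    Implements (i ⋆ l) (j ⋆ k ⋆ l) (splitTensor X' f) g := by
  simpa only [one_mul, splitTensor] using (assoc j k l).comp (h.rTensor l)

theorem pair {i' : X' →ₗ[R] E} {j' : Y' →ₗ[R] E} {f : X ⊗[R] Y →ₗ[R] X' ⊗[R] Y'}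
    (h : Implements (i ⋆ j) (i' ⋆ j') f g) (l : Z →ₗ[R] E) :
    Implements (i ⋆ j ⋆ l) (i' ⋆ j' ⋆ l) (pairTensor Z f) g := by
  simpa only [one_mul, mul_one, pairTensor] using
    (assoc i' j' l).comp ((h.rTensor l).comp (assoc_symm i j l))

theorem evalLeft {f : X →ₗ[R] R} (h : Implements i (Algebra.linearMap R E) f g)
    (k : Z →ₗ[R] E) :
    Implements (i ⋆ k) k ((TensorProduct.lid R Z).toLinearMap ∘ₗ f.rTensor Z) g :=
  TensorProduct.ext' fun x z => by simp [← mul_assoc, h.apply, Algebra.smul_def]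

end Implements

end Implements

/-! ### Absorption -/

/-- An identification of an algebra `E` with the module of linear maps `A → E`, given by
`g ↦ (a ↦ g * insert a)`. The example to have in mind is the endomorphism algebra of a module
`M ≅ A ⊗ M`. -/
structure Absorption (R A E : Type*) [CommSemiring R] [AddCommMonoid A] [Module R A] [Semiring E]
    [Algebra R E] where
  insert : A →ₗ[R] E
  extend : (A →ₗ[R] E) →ₗ[R] E
  extend_mul_insert : ∀ F a, extend F * insert a = F a
  ext : ∀ {g g'}, (∀ a, g * insert a = g' * insert a) → g = g'

namespace Absorption

section

variable {R A E : Type*} [CommSemiring R] [AddCommMonoid A] [Module R A] [Semiring E] [Algebra R E]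
variable (P : Absorption R A E)

local infixr:70 " ⋆ " => tensorMul

/-- The operation `h ↦ id ⊗ h`. -/
def shift : E →* E where
  toFun h := P.extend (LinearMap.mulRight R h ∘ₗ P.insert)
  map_one' := P.ext fun a => by simp [extend_mul_insert]
  map_mul' h h' := P.ext fun a => by
    rw [mul_assoc, extend_mul_insert, extend_mul_insert]
    simp [← mul_assoc, extend_mul_insert]

theorem shift_mul_insert (h : E) (a : A) : P.shift h * P.insert a = P.insert a * h :=
  P.extend_mul_insert _ _

/-- The element of `E` that implements `F` on two factors. -/
def extend₂ (F : A ⊗[R] A →ₗ[R] E) : E := P.extend (P.extend ∘ₗ TensorProduct.curry F)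

theorem extend₂_mul (F : A ⊗[R] A →ₗ[R] E) (x : A ⊗[R] A) :
    P.extend₂ F * (P.insert ⋆ P.insert) x = F x := by
  refine LinearMap.congr_fun (f := LinearMap.mulLeft R (P.extend₂ F) ∘ₗ (P.insert ⋆ P.insert)) ?_ x
  ext
  simp [extend₂, ← mul_assoc, extend_mul_insert]

theorem implements_extend {Y : Type*} [AddCommMonoid Y] [Module R Y] (j : Y →ₗ[R] E)
    (f : A →ₗ[R] Y) : Implements P.insert j f (P.extend (j ∘ₗ f)) :=
  .of_apply (P.extend_mul_insert _)

theorem implements_extend₂ {Y : Type*} [AddCommMonoid Y] [Module R Y] (j : Y →ₗ[R] E)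
    (f : A ⊗[R] A →ₗ[R] Y) : Implements (P.insert ⋆ P.insert) j f (P.extend₂ (j ∘ₗ f)) :=
  .of_apply (P.extend₂_mul _)

/-- The map `k : Z → E` behaves as the embedding of the `n`-th tensor power of `A`: the `n`-fold
shift moves elements of `E` past it, and they are determined by their action on its image. -/
structure IsPower {Z : Type*} [AddCommMonoid Z] [Module R Z] (n : ℕ) (k : Z →ₗ[R] E) : Prop where
  shift_mul : ∀ h z, P.shift^[n] h * k z = k z * h
  ext : ∀ {g g'}, (∀ z, g * k z = g' * k z) → g = g'

theorem isPower_zero : P.IsPower 0 (Algebra.linearMap R E) where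
  shift_mul h r := (Algebra.commutes r h).symm
  ext h := by simpa using h 1

theorem isPower_one : P.IsPower 1 P.insert where
  shift_mul := P.shift_mul_insert
  ext := P.ext

variable {X Y Z : Type*} [AddCommMonoid X] [Module R X] [AddCommMonoid Y] [Module R Y]
  [AddCommMonoid Z] [Module R Z]
variable {n m : ℕ} {i : X →ₗ[R] E} {j : Y →ₗ[R] E} {k : Z →ₗ[R] E}
variable {f f' : X →ₗ[R] Y} {g g' : E}

namespace IsPower

variable {P}

theorem insert_tensorMul (hk : P.IsPower n k) : P.IsPower (n + 1) (P.insert ⋆ k) where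
  shift_mul h x := by
    refine LinearMap.congr_fun (f := LinearMap.mulLeft R (P.shift^[n + 1] h) ∘ₗ (P.insert ⋆ k))
      (g := LinearMap.mulRight R h ∘ₗ (P.insert ⋆ k)) (TensorProduct.ext' fun a z => ?_) x
    calc
      _ = P.insert a * (P.shift^[n] h * k z) := by
        simp [Function.iterate_succ_apply', ← mul_assoc, shift_mul_insert]
      _ = _ := by simp [hk.shift_mul, mul_assoc]
  ext h := P.ext fun a => hk.ext fun z => by simpa [mul_assoc] using h (a ⊗ₜ z)

theorem eq_of_implements (hi : P.IsPower n i) (h : Implements i j f g) (h' : Implements i j f' g')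
    (hf : f = f') : g = g' :=
  hi.ext fun x => by rw [h.apply, h'.apply, hf]

theorem isLocal_of_implements (hi : P.IsPower n i) (hj : P.IsPower m j)
    (h : Implements i j f g) : IsLocal P.shift n m g := fun u =>
  hi.ext fun x => by
    rw [mul_assoc, hi.shift_mul, ← mul_assoc, h.apply, mul_assoc, h.apply, hj.shift_mul]

end IsPower

theorem isPower_two : P.IsPower 2 (P.insert ⋆ P.insert) := P.isPower_one.insert_tensorMul

theorem isPower_three : P.IsPower 3 (P.insert ⋆ P.insert ⋆ P.insert) :=
  P.isPower_two.insert_tensorMul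

theorem _root_.Implements.shift (h : Implements i j f g) :
    Implements (P.insert ⋆ i) (P.insert ⋆ j) (f.lTensor A) (P.shift g) :=
  TensorProduct.ext' fun a x => by simp [← mul_assoc, shift_mul_insert, ← h.apply]

theorem _root_.Implements.evalRight {f : X →ₗ[R] R}
    (h : Implements i (Algebra.linearMap R E) f g) :
    Implements (P.insert ⋆ i) P.insert ((TensorProduct.rid R A).toLinearMap ∘ₗ f.lTensor A)
      (P.shift g) :=
  TensorProduct.ext' fun a x =>
    calc
      _ = P.insert a * (g * i x) := by simp [← mul_assoc, shift_mul_insert]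
      _ = _ := by simp [h.apply, Algebra.smul_def, Algebra.commutes]

theorem insert_tensorMul_injective [Module.Free R A] (hk : Function.Injective k) :
    Function.Injective (P.insert ⋆ k) := by
  classical
  let b := Module.Free.chooseBasis R A
  intro x y hxy
  apply (TensorProduct.equivFinsuppOfBasisLeft b).injective
  ext t
  have h := (P.implements_extend (Algebra.linearMap R E) (b.coord t)).evalLeft k
  have := hk ((h.apply x).symm.trans ((congrArg _ hxy).trans (h.apply y)))
  simpa [TensorProduct.equivFinsuppOfBasisLeft_apply] using this

theorem insert_injective [Module.Free R A] (hR : Function.Injective (algebraMap R E)) :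
    Function.Injective P.insert := by
  let b := Module.Free.chooseBasis R A
  intro x y hxy
  apply b.ext_elem
  intro t
  have h := P.implements_extend (Algebra.linearMap R E) (b.coord t)
  exact hR ((h.apply x).symm.trans ((congrArg _ hxy).trans (h.apply y)))

end

section Operators

open Coalgebra

variable {R A E : Type*} [CommSemiring R] [Semiring E] [Algebra R E]

local infixr:70 " ⋆ " => tensorMul

section Crossing

variable [AddCommMonoid A] [Module R A] (P : Absorption R A E)

/-- The element of `E` that implements an endomorphism of `A ⊗ A`. -/
def crossing (f : A ⊗[R] A →ₗ[R] A ⊗[R] A) : E := P.extend₂ ((P.insert ⋆ P.insert) ∘ₗ f)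

theorem implements_crossing (f : A ⊗[R] A →ₗ[R] A ⊗[R] A) :
    Implements (P.insert ⋆ P.insert) (P.insert ⋆ P.insert) f (P.crossing f) :=
  P.implements_extend₂ _ f

/-- The element of `E` that implements an automorphism of `A ⊗ A`, as a unit of `E`. -/
def crossingUnit (f : A ⊗[R] A ≃ₗ[R] A ⊗[R] A) : Eˣ where
  val := P.crossing f.toLinearMap
  inv := P.crossing f.symm.toLinearMap
  val_inv := P.isPower_two.eq_of_implements
    ((P.implements_crossing _).comp (P.implements_crossing _)) (.one _) (by simp)
  inv_val := P.isPower_two.eq_of_implements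
    ((P.implements_crossing _).comp (P.implements_crossing _)) (.one _) (by simp)

end Crossing

section Algebra

variable [Semiring A] [Algebra R A] (P : Absorption R A E)

/-- The element of `E` that implements the product of `A`. -/
def mul : E := P.extend₂ (P.insert ∘ₗ LinearMap.mul' R A)

theorem implements_mul : Implements (P.insert ⋆ P.insert) P.insert (LinearMap.mul' R A) P.mul :=
  P.implements_extend₂ _ _

theorem implements_unit :
    Implements (Algebra.linearMap R E) P.insert (Algebra.linearMap R A) (P.insert 1) :=
  .of_apply fun r => by simp [Algebra.algebraMap_eq_smul_one]

theorem mul_mul : P.mul * P.mul = P.mul * P.shift P.mul :=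
  P.isPower_three.eq_of_implements (P.implements_mul.comp (P.implements_mul.merge _))
    (P.implements_mul.comp (P.implements_mul.shift P)) (by ext; simp [mergeTensor, mul_assoc])

theorem mul_unit : P.mul * P.insert 1 = 1 := P.ext fun a => by
  simpa [mul_assoc] using P.implements_mul.apply (1 ⊗ₜ a)

theorem mul_shift_unit : P.mul * P.shift (P.insert 1) = 1 := P.ext fun a => by
  simpa [mul_assoc, P.shift_mul_insert] using P.implements_mul.apply (a ⊗ₜ 1)

end Algebra

section Coalgebra

variable [AddCommMonoid A] [Module R A] [Coalgebra R A] (P : Absorption R A E)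

/-- The element of `E` that implements the coproduct of `A`. -/
def comul : E := P.extend ((P.insert ⋆ P.insert) ∘ₗ Coalgebra.comul)

/-- The element of `E` that implements the counit of `A`. -/
def counit : E := P.extend (Algebra.linearMap R E ∘ₗ Coalgebra.counit)

theorem implements_comul :
    Implements P.insert (P.insert ⋆ P.insert) (Coalgebra.comul (R := R)) P.comul :=
  P.implements_extend _ _

theorem implements_counit :
    Implements P.insert (Algebra.linearMap R E) (Coalgebra.counit (R := R)) P.counit :=
  P.implements_extend _ _

theorem comul_comul : P.comul * P.comul = P.shift P.comul * P.comul :=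
  P.isPower_one.eq_of_implements ((P.implements_comul.split _).comp P.implements_comul)
    ((P.implements_comul.shift P).comp P.implements_comul) coassoc

theorem counit_comul : P.counit * P.comul = 1 :=
  P.isPower_one.eq_of_implements ((P.implements_counit.evalLeft _).comp P.implements_comul)
    (.one _) (by rw [LinearMap.comp_assoc, rTensor_counit_comp_comul]; ext; simp)

theorem shift_counit_comul : P.shift P.counit * P.comul = 1 :=
  P.isPower_one.eq_of_implements ((P.implements_counit.evalRight P).comp P.implements_comul)
    (.one _) (by rw [LinearMap.comp_assoc, lTensor_counit_comp_comul]; ext; simp)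

end Coalgebra

end Operators

section Existence

variable {R A M : Type*} [CommSemiring R] [AddCommMonoid A] [Module R A] [AddCommMonoid M]
  [Module R M]

/-- The absorption given by an isomorphism `A ⊗ M ≅ M`. -/
def ofLinearEquiv (c : A ⊗[R] M ≃ₗ[R] M) : Absorption R A (Module.End R M) where
  insert := (TensorProduct.mk R A M).compr₂ c.toLinearMap
  extend := LinearMap.lcomp R M c.symm.toLinearMap ∘ₗ TensorProduct.uncurry (.id R) A M M
  extend_mul_insert F a := by ext; simp
  ext h := by
    refine LinearMap.ext fun x => ?_
    obtain ⟨y, rfl⟩ := c.surjective x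
    refine LinearMap.congr_fun (f := _ ∘ₗ c.toLinearMap) (g := _ ∘ₗ c.toLinearMap) ?_ y
    exact TensorProduct.ext' fun a m => LinearMap.congr_fun (h a) m

/-- The absorption on the free module on the sequences of elements of a basis of `A`: such a
sequence is an element of the basis followed by another sequence. -/
def ofBasis {I : Type*} (b : Module.Basis I R A) :
    Absorption R A (Module.End R ((ℕ → I) →₀ R)) :=
  ofLinearEquiv <|
    TensorProduct.congr b.repr (.refl R _) ≪≫ₗ finsuppTensorFinsupp' R I (ℕ → I) ≪≫ₗ
      Finsupp.domLCongr ((Equiv.piOptionEquivProd (β := fun _ : Option ℕ => I)).symm.trans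
        ((Denumerable.eqv (Option ℕ)).arrowCongr (.refl I)))

end Existence

end Absorption

theorem algebraMap_end_injective {R M : Type*} [CommSemiring R] [AddCommMonoid M] [Module R M]
    [FaithfulSMul R M] : Function.Injective (algebraMap R (Module.End R M)) := fun _ _ h =>
  FaithfulSMul.eq_of_smul_eq_smul fun x : M => LinearMap.congr_fun h x

/-! ### Braided Hopf algebras -/

open Coalgebra LinearMap

/-- A braided quantum group over a commutative semiring, with flip-over operator `σ` and an antipode
`κ` that need not be bijective. Tensor powers are bracketed to the right. -/
structure BraidedHopfStructure (R A : Type*) [CommSemiring R] [Semiring A] [Algebra R A]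
    [Coalgebra R A] where
  σ : A ⊗[R] A ≃ₗ[R] A ⊗[R] A
  κ : A →ₗ[R] A
  flip_mul_left : σ.toLinearMap ∘ₗ mergeTensor A (mul' R A) =
    (mul' R A).lTensor A ∘ₗ pairTensor A σ.toLinearMap ∘ₗ σ.toLinearMap.lTensor A
  flip_mul_right : σ.toLinearMap ∘ₗ (mul' R A).lTensor A =
    mergeTensor A (mul' R A) ∘ₗ σ.toLinearMap.lTensor A ∘ₗ pairTensor A σ.toLinearMap
  comul_mul : comul (R := R) ∘ₗ mul' R A =
    TensorProduct.map (mul' R A) (mul' R A) ∘ₗ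
      ((TensorProduct.assoc R A A (A ⊗[R] A)).symm.toLinearMap ∘ₗ
        (pairTensor A σ.toLinearMap).lTensor A ∘ₗ
        (TensorProduct.assoc R A A (A ⊗[R] A)).toLinearMap) ∘ₗ
      TensorProduct.map comul comul
  flip_comul :
    pairTensor (A ⊗[R] A) σ.toLinearMap ∘ₗ (splitTensor A comul).lTensor A ∘ₗ
      pairTensor A σ.symm.toLinearMap ∘ₗ comul.lTensor A =
    (σ.toLinearMap.lTensor A).lTensor A ∘ₗ (splitTensor A comul).lTensor A ∘ₗ
      σ.symm.toLinearMap.lTensor A ∘ₗ splitTensor A comul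
  mul_antipode_right : mul' R A ∘ₗ κ.lTensor A ∘ₗ comul (R := R) =
    Algebra.linearMap R A ∘ₗ counit (R := R)
  mul_antipode_left : mul' R A ∘ₗ κ.rTensor A ∘ₗ comul (R := R) =
    Algebra.linearMap R A ∘ₗ counit (R := R)

namespace BraidedHopfStructure

variable {R A : Type*} [CommSemiring R] [Semiring A] [Algebra R A] [Coalgebra R A]
variable (H : BraidedHopfStructure R A)

local infixr:70 " ⋆ " => tensorMul

/-- The secondary flip `τ = (id² ⊗ ε) (id ⊗ σ⁻¹) (φ ⊗ id) σ`. -/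
def τ : A ⊗[R] A →ₗ[R] A ⊗[R] A :=
  ((TensorProduct.rid R A).toLinearMap ∘ₗ (counit (R := R) (A := A)).lTensor A).lTensor A ∘ₗ
    H.σ.symm.toLinearMap.lTensor A ∘ₗ splitTensor A comul ∘ₗ H.σ.toLinearMap

theorem comul_mul' : comul (R := R) ∘ₗ mul' R A =
    mergeTensor A (mul' R A) ∘ₗ ((mul' R A).lTensor A).lTensor A ∘ₗ
      (pairTensor A H.σ.toLinearMap).lTensor A ∘ₗ splitTensor (A ⊗[R] A) comul ∘ₗ
      comul.lTensor A := by
  have h₁ : splitTensor (A ⊗[R] A) (comul (R := R) (A := A)) ∘ₗ comul.lTensor A =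
      (TensorProduct.assoc R A A (A ⊗[R] A)).toLinearMap ∘ₗ TensorProduct.map comul comul := by
    rw [splitTensor, comp_assoc, rTensor_comp_lTensor]
  have h₂ : mergeTensor A (mul' R A) ∘ₗ ((mul' R A).lTensor A).lTensor A =
      TensorProduct.map (mul' R A) (mul' R A) ∘ₗ
        (TensorProduct.assoc R A A (A ⊗[R] A)).symm.toLinearMap := by
    ext
    simp [mergeTensor]
  rw [H.comul_mul, h₁]
  simp only [← comp_assoc, h₂]

variable {E : Type*} [Semiring E] [Algebra R E] (P : Absorption R A E)

theorem crossing_mul : P.crossing H.σ.toLinearMap * P.mul =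
    P.shift P.mul * P.crossing H.σ.toLinearMap * P.shift (P.crossing H.σ.toLinearMap) :=
  P.isPower_three.eq_of_implements
    ((P.implements_crossing _).comp (P.implements_mul.merge _))
    (((P.implements_mul.shift P).comp ((P.implements_crossing _).pair _)).comp
      ((P.implements_crossing _).shift P)) H.flip_mul_left

theorem crossing_shift_mul : P.crossing H.σ.toLinearMap * P.shift P.mul =
    P.mul * P.shift (P.crossing H.σ.toLinearMap) * P.crossing H.σ.toLinearMap :=
  P.isPower_three.eq_of_implements
    ((P.implements_crossing _).comp (P.implements_mul.shift P))
    (((P.implements_mul.merge _).comp ((P.implements_crossing _).shift P)).comp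
      ((P.implements_crossing _).pair _)) H.flip_mul_right

theorem comul_mul_eq : P.comul * P.mul = P.mul * P.shift (P.shift P.mul) *
    P.shift (P.crossing H.σ.toLinearMap) * P.comul * P.shift P.comul :=
  P.isPower_two.eq_of_implements (P.implements_comul.comp P.implements_mul)
    (((((P.implements_mul.merge _).comp ((P.implements_mul.shift P).shift P)).comp
      (((P.implements_crossing _).pair _).shift P)).comp (P.implements_comul.split _)).comp
      (P.implements_comul.shift P)) H.comul_mul'

theorem crossing_comul :
    P.crossing H.σ.toLinearMap * P.shift P.comul * P.crossing H.σ.symm.toLinearMap *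
        P.shift P.comul =
      P.shift (P.shift (P.crossing H.σ.toLinearMap)) * P.shift P.comul *
        P.shift (P.crossing H.σ.symm.toLinearMap) * P.comul :=
  P.isPower_two.eq_of_implements
    (((((P.implements_crossing _).pair _).comp ((P.implements_comul.split _).shift P)).comp
      ((P.implements_crossing _).pair _)).comp (P.implements_comul.shift P))
    ((((((P.implements_crossing _).shift P).shift P).comp
      ((P.implements_comul.split _).shift P)).comp
      ((P.implements_crossing _).shift P)).comp (P.implements_comul.split _)) H.flip_comul

/-- The structure maps of `A` as elements of an algebra absorbing `A`. -/
def calculus : BraidedCalculus E where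
  shift := P.shift
  flip := P.crossingUnit H.σ
  mul := P.mul
  comul := P.comul
  counit := P.counit
  antipode := P.extend (P.insert ∘ₗ H.κ)
  unit := P.insert 1
  isLocal_flip := P.isPower_two.isLocal_of_implements P.isPower_two (P.implements_crossing _)
  isLocal_mul := P.isPower_two.isLocal_of_implements P.isPower_one P.implements_mul
  isLocal_comul := P.isPower_one.isLocal_of_implements P.isPower_two P.implements_comul
  isLocal_counit := P.isPower_one.isLocal_of_implements P.isPower_zero P.implements_counit
  isLocal_antipode :=
    P.isPower_one.isLocal_of_implements P.isPower_one (P.implements_extend P.insert H.κ)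
  isLocal_unit := P.isPower_zero.isLocal_of_implements P.isPower_one P.implements_unit
  mul_mul := P.mul_mul
  mul_unit := P.mul_unit
  mul_shift_unit := P.mul_shift_unit
  comul_comul := P.comul_comul
  counit_comul := P.counit_comul
  shift_counit_comul := P.shift_counit_comul
  flip_mul := H.crossing_mul P
  flip_shift_mul := H.crossing_shift_mul P
  comul_mul := H.comul_mul_eq P
  flip_comul := H.crossing_comul P
  mul_shift_antipode_comul := P.isPower_one.eq_of_implements
    ((P.implements_mul.comp ((P.implements_extend _ _).shift P)).comp P.implements_comul)
    (P.implements_unit.comp P.implements_counit) H.mul_antipode_right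
  mul_antipode_comul := P.isPower_one.eq_of_implements
    ((P.implements_mul.comp ((P.implements_extend _ _).rTensor _)).comp P.implements_comul)
    (P.implements_unit.comp P.implements_counit) H.mul_antipode_left

theorem implements_secondaryFlip :
    Implements (P.insert ⋆ P.insert) (P.insert ⋆ P.insert) H.τ (H.calculus P).secondaryFlip :=
  ((((P.implements_counit.evalRight P).shift P).comp ((P.implements_crossing _).shift P)).comp
    (P.implements_comul.split _)).comp (P.implements_crossing _)

/-- The two flips `σ` and `τ`. -/
def flips : Set (A ⊗[R] A →ₗ[R] A ⊗[R] A) := {H.σ.toLinearMap, H.τ}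

variable {H} in
theorem exists_mem_flips_implements {α : A ⊗[R] A →ₗ[R] A ⊗[R] A} (hα : α ∈ H.flips) :
    ∃ a ∈ (H.calculus P).flips, Implements (P.insert ⋆ P.insert) (P.insert ⋆ P.insert) α a := by
  obtain rfl | rfl := hα
  · exact ⟨_, BraidedCalculus.flip_mem_flips, P.implements_crossing _⟩
  · exact ⟨_, BraidedCalculus.secondaryFlip_mem_flips, H.implements_secondaryFlip P⟩

theorem braid_of_injective
    (hP : Function.Injective (P.insert ⋆ P.insert ⋆ P.insert)) {α β γ : A ⊗[R] A →ₗ[R] A ⊗[R] A}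
    (hα : α ∈ H.flips) (hβ : β ∈ H.flips) (hγ : γ ∈ H.flips) :
    pairTensor A α ∘ₗ β.lTensor A ∘ₗ pairTensor A γ =
      γ.lTensor A ∘ₗ pairTensor A β ∘ₗ α.lTensor A := by
  obtain ⟨a, ha, hαa⟩ := exists_mem_flips_implements P hα
  obtain ⟨b, hb, hβb⟩ := exists_mem_flips_implements P hβ
  obtain ⟨c, hc, hγc⟩ := exists_mem_flips_implements P hγ
  have braid : a * P.shift b * c = P.shift c * b * P.shift a := BraidedCalculus.braid ha hb hc
  refine Implements.injective hP (((hαa.pair _).comp (hβb.shift P)).comp (hγc.pair _)) ?_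
  rw [braid]
  exact ((hγc.shift P).comp (hβb.pair _)).comp (hαa.shift P)

end BraidedHopfStructure

theorem mainTheorem1_general {R A : Type*} [CommSemiring R] [Semiring A] [Algebra R A]
    [Coalgebra R A] [Module.Free R A] (H : BraidedHopfStructure R A)
    {α β γ : A ⊗[R] A →ₗ[R] A ⊗[R] A} (hα : α ∈ H.flips) (hβ : β ∈ H.flips) (hγ : γ ∈ H.flips) :
    pairTensor A α ∘ₗ β.lTensor A ∘ₗ pairTensor A γ =
      γ.lTensor A ∘ₗ pairTensor A β ∘ₗ α.lTensor A := by
  cases subsingleton_or_nontrivial A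
  · exact Subsingleton.elim _ _
  · let P := Absorption.ofBasis (Module.Free.chooseBasis R A)
    have hP : Function.Injective P.insert := P.insert_injective algebraMap_end_injective
    exact H.braid_of_injective P
      (P.insert_tensorMul_injective (P.insert_tensorMul_injective hP)) hα hβ hγ

/-- A braided quantum group as a braided Hopf structure over `ℂ`, which forgets that the antipode
is bijective. -/
def BraidedQuantumGroup.toBraidedHopfStructure {A : Type*} [Ring A] [Algebra ℂ A] [Coalgebra ℂ A]
    (G : BraidedQuantumGroup A) : BraidedHopfStructure ℂ A where
  σ := G.σ
  κ := G.κ.toLinearMap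
  flip_mul_left := G.flip_mul_left
  flip_mul_right := G.flip_mul_right
  comul_mul := G.comul_mul
  flip_comul := G.flip_comul
  mul_antipode_right := G.mul_antipode_right
  mul_antipode_left := G.mul_antipode_left

end

open BraidedQG in
theorem mainTheorem1 {A : Type*} [Ring A] [Algebra ℂ A] [Coalgebra ℂ A]
    (G : BraidedQuantumGroup A) :
    (tensorId A G.σ.toLinearMap ∘ₗ idTensor G.σ.toLinearMap ∘ₗ tensorId A G.σ.toLinearMap =
      idTensor G.σ.toLinearMap ∘ₗ tensorId A G.σ.toLinearMap ∘ₗ idTensor G.σ.toLinearMap) ∧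
    (tensorId A G.τ ∘ₗ idTensor G.σ.toLinearMap ∘ₗ tensorId A G.σ.toLinearMap =
      idTensor G.σ.toLinearMap ∘ₗ tensorId A G.σ.toLinearMap ∘ₗ idTensor G.τ) ∧
    (tensorId A G.σ.toLinearMap ∘ₗ idTensor G.τ ∘ₗ tensorId A G.σ.toLinearMap =
      idTensor G.σ.toLinearMap ∘ₗ tensorId A G.τ ∘ₗ idTensor G.σ.toLinearMap) ∧
    (tensorId A G.σ.toLinearMap ∘ₗ idTensor G.σ.toLinearMap ∘ₗ tensorId A G.τ =
      idTensor G.τ ∘ₗ tensorId A G.σ.toLinearMap ∘ₗ idTensor G.σ.toLinearMap) ∧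
    (tensorId A G.τ ∘ₗ idTensor G.τ ∘ₗ tensorId A G.σ.toLinearMap =
      idTensor G.σ.toLinearMap ∘ₗ tensorId A G.τ ∘ₗ idTensor G.τ) ∧
    (tensorId A G.τ ∘ₗ idTensor G.σ.toLinearMap ∘ₗ tensorId A G.τ =
      idTensor G.τ ∘ₗ tensorId A G.σ.toLinearMap ∘ₗ idTensor G.τ) ∧
    (tensorId A G.σ.toLinearMap ∘ₗ idTensor G.τ ∘ₗ tensorId A G.τ =
      idTensor G.τ ∘ₗ tensorId A G.τ ∘ₗ idTensor G.σ.toLinearMap) ∧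
    (tensorId A G.τ ∘ₗ idTensor G.τ ∘ₗ tensorId A G.τ =
      idTensor G.τ ∘ₗ tensorId A G.τ ∘ₗ idTensor G.τ) := by
  let H := G.toBraidedHopfStructure
  have hσ : G.σ.toLinearMap ∈ H.flips := Or.inl rfl
  have hτ : G.τ ∈ H.flips := Or.inr rfl
  exact ⟨mainTheorem1_general H hσ hσ hσ, mainTheorem1_general H hτ hσ hσ,
    mainTheorem1_general H hσ hτ hσ, mainTheorem1_general H hσ hσ hτ,
    mainTheorem1_general H hτ hτ hσ, mainTheorem1_general H hτ hσ hτ,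
    mainTheorem1_general H hσ hτ hτ, mainTheorem1_general H hτ hτ hτ⟩
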